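/- Let $0<q<1$ and $a>0$. Write $(x;q)_n=\prod_{k=0}^{n-1}(1-xq^k)$ and $(x;q)_\infty=\prod_{k\ge 0}(1-xq^k)$. Let $\mathcal H$ be a complex Hilbert space with orthonormal basis $(e_n)_{n\ge 0}$, and put $$a_n=-(aq^{3n+1})^{1/2}\,\frac{\sqrt{(1-q^{n+1})(1+aq^n)}}{(1+aq^{2n+1})\sqrt{(1+aq^{2n})(1+aq^{2n+2})}},$$ $$b_n=q^n\left(\frac{1+aq^n}{(1+aq^{2n})(1+aq^{2n+1})}+aq^{n-1}\frac{1-q^n}{(1+aq^{2n-1})(1+aq^{2n})}\right).$$ Then there is exactly one bounded operator $I_1$ on $\mathcal H$ with $I_1e_n=a_ne_{n+1}+a_{n-1}e_{n-1}+b_ne_n$ for all $n\ge 0$ (the middle term being absent for $n=0$). It is self-adjoint and of trace class, and: (i) the set of eigenvalues of $I_1$ is exactly $\{q^n: n=0,1,2,\dots\}$; the spectrum of $I_1$ consists of these eigenvalues together with the point $0$, which is its only accumulation point and is not an eigenvalue; (ii) the spectrum is simple: $I_1$ has a cyclic vector, and each eigenvalue $q^n$ has a one-dimensional eigenspace; (iii)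 the probability measure with mass $\frac{1}{(-aq;q)_\infty}\frac{a^nq^{n(n+1)/2}}{(q;q)_n}$ at $q^n$, $n\ge 0$, is the spectral measure of $I_1$ at $e_0$, i.e. for all $k\ge 0$ $$\langle e_0, I_1^k e_0\rangle=\frac{1}{(-aq;q)_\infty}\sum_{n=0}^\infty \frac{a^nq^{n(n+1)/2}}{(q;q)_n}\,q^{nk}.$$ Moreover, the alternative $q$-Charlier polynomials $$K_m(x;a;q)={}_2\phi_1(q^{-m},-aq^m;0;q,qx)=\sum_{k=0}^m\frac{(q^{-m};q)_k(-aq^m;q)_k}{(q;q)_k}(qx)^k$$ satisfy, for all $m,m'\ge 0$, $$\sum_{n=0}^\infty\frac{a^nq^{n(n+1)/2}}{(q;q)_n}K_m(q^n;a;q)K_{m'}(q^n;a;q)=\frac{(-aq^m;q)_\infty\,a^m\,(q;q)_m}{1+aq^{2m}}\,q^{m(m+1)/2}\,\delta_{mm'},$$ and there is no further mass: a positive Borel measure $\mu$ on $\mathbb R$ has all products $K_mK_{m'}$ integrable with $\int K_mK_{m'}\,d\mu$ equal to the right-hand side above for all $m,m'\ge 0$ if and only if $\mu=\sum_{n\ge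 0}\frac{a^nq^{n(n+1)/2}}{(q;q)_n}\,\delta_{q^n}$. -/

import Mathlib

open MeasureTheory

noncomputable section

namespace AltQCharlier

/-- The finite `q`-shifted factorial `(x;q)_n = ∏_{k<n} (1 - x q^k)`. -/
def qPoch (x q : ℝ) (n : ℕ) : ℝ := ∏ k ∈ Finset.range n, (1 - x * q ^ k)

/-- The infinite `q`-shifted factorial `(x;q)_∞ = ∏_{k≥0} (1 - x q^k)`. -/
def qPochInf (x q : ℝ) : ℝ := ∏' k : ℕ, (1 - x * q ^ k)

/-- The basic hypergeometric series `₂φ₁(α, β; γ; q, z)`. -/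
def phi21 (α β γ q z : ℝ) : ℝ :=
  ∑' k : ℕ, qPoch α q k * qPoch β q k / (qPoch γ q k * qPoch q q k) * z ^ k

/-- The alternative `q`-Charlier polynomial
`K_n(x;a;q) = ₂φ₁(q^{-n}, -a q^n; 0; q, q x)`; the series terminates at `k = n`. -/
def altCharlier (a q : ℝ) (n : ℕ) (x : ℝ) : ℝ :=
  phi21 (q ^ (-(n : ℤ))) (-a * q ^ n) 0 q (q * x)

/-- The off-diagonal coefficient `a_n`. -/
def offDiag (a q : ℝ) (n : ℕ) : ℝ :=
  -(Real.sqrt (a * q ^ (3 * n + 1)) *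
    (Real.sqrt ((1 - q ^ (n + 1)) * (1 + a * q ^ n)) /
      ((1 + a * q ^ (2 * n + 1)) *
        Real.sqrt ((1 + a * q ^ (2 * n)) * (1 + a * q ^ (2 * n + 2))))))

/-- The diagonal coefficient `b_n`. Integer exponents are used where the exponent is negative
at `n = 0`. -/
def diag (a q : ℝ) (n : ℕ) : ℝ :=
  q ^ n * ((1 + a * q ^ n) / ((1 + a * q ^ (2 * n)) * (1 + a * q ^ (2 * n + 1))) +
    a * q ^ ((n : ℤ) - 1) *
      ((1 - q ^ n) / ((1 + a * q ^ (2 * (n : ℤ) - 1)) * (1 + a * q ^ (2 * n)))))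

/-- The weight `a^n q^{n(n+1)/2} / (q;q)_n` at the point `q^n`. -/
def weight (a q : ℝ) (n : ℕ) : ℝ := a ^ n * q ^ (n * (n + 1) / 2) / qPoch q q n

/-- The squared norm
`(-a q^m;q)_∞ a^m (q;q)_m q^{m(m+1)/2} / (1 + a q^{2m})` of `K_m`. -/
def normSq (a q : ℝ) (m : ℕ) : ℝ :=
  qPochInf (-a * q ^ m) q * a ^ m * qPoch q q m / (1 + a * q ^ (2 * m)) *
    q ^ (m * (m + 1) / 2)

/-- The purely atomic measure `∑_n (a^n q^{n(n+1)/2} / (q;q)_n) δ_{q^n}` on the real line. -/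
def discreteMeasure (a q : ℝ) : Measure ℝ :=
  Measure.sum fun n : ℕ => ENNReal.ofReal (weight a q n) • Measure.dirac (q ^ n)

/-- `μ` is an orthogonality measure for the polynomials `K_m(·;a;q)`, with squared norms
`normSq a q m`. -/
def IsOrthogonalityMeasure (a q : ℝ) (μ : Measure ℝ) : Prop :=
  ∀ m m' : ℕ, Integrable (fun x => altCharlier a q m x * altCharlier a q m' x) μ ∧
    ∫ x, altCharlier a q m x * altCharlier a q m' x ∂μ = if m = m' then normSq a q m else 0

section Operators

universe u

variable {H : Type u} [NormedAddCommGroup H] [InnerProductSpace ℂ H] [CompleteSpace H]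

/-- The bounded operator `T` acts on the orthonormal basis `e` by
`T e_n = a_n e_{n+1} + a_{n-1} e_{n-1} + b_n e_n` (for `n = 0` the middle term is absent). -/
def IsJacobiOperator (a q : ℝ) (e : HilbertBasis ℕ ℂ H) (T : H →L[ℂ] H) : Prop :=
  T (e 0) = (offDiag a q 0 : ℂ) • e 1 + (diag a q 0 : ℂ) • e 0 ∧
  ∀ n : ℕ, T (e (n + 1)) = (offDiag a q (n + 1) : ℂ) • e (n + 2) +
    (offDiag a q n : ℂ) • e n + (diag a q (n + 1) : ℂ) • e (n + 1)

/-- Trace class operators: `tr |T| = ∑_i ⟨b_i, |T| b_i⟩` is finite, in every orthonormal basis,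
where `|T| = (T* T)^{1/2}`. -/
def IsTraceClass (T : H →L[ℂ] H) : Prop :=
  ∀ (ι : Type u) (b : HilbertBasis ι ℂ H),
    Summable fun i => RCLike.re (inner ℂ (b i) (CFC.abs T (b i)))

/-- A bounded (self-adjoint) operator has simple spectrum if it has a cyclic vector `v`: the
linear span of `v, T v, T² v, …` is dense. -/
def HasSimpleSpectrum (T : H →L[ℂ] H) : Prop :=
  ∃ v : H, (Submodule.span ℂ (Set.range fun k : ℕ => (T ^ k) v)).topologicalClosure = ⊤

end Operators

end AltQCharlier

end

noncomputable section

namespace AltQCharlier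

open Filter Topology

/-! `I₁` is multiplication by `x` on ℓ² of the weights `w_n` at the nodes `q^n`, written in the
basis of normalized polynomials `K_m`. Three facts carry this.

Recurrence: `x K_m` is a combination of `K_{m+1}`, `K_m`, `K_{m-1}` with coefficients `-A_m`, `A_m +
C_{m-1}`, `-C_{m-1}` (`raiseCoeff`, `lowerCoeff`). Since `a_m² = A_m C_m`, normalizing the `K_m`
turns it into the given Jacobi matrix.

Orthogonality: the ratio `w_{n+1}/w_n` gives a first-order recurrence for the moments, from which
the sum of `w_n K_m(q^n)` vanishes for `m ≥ 1` (`weightSum_charlierMap_succ`). The three-term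
recurrence then yields all orthogonality relations and the ratios of the norms.

Completeness: a summable sequence on the nodes whose power moments all vanish is zero
(`eq_zero_of_hasSum_mul_pow`). So the matrix of normalized values is unitary, and it supplies an
orthonormal basis `f` in which `I₁` is diagonal with entries `q^n`
(`isJacobiOperator_iff_isDiagonal`). The spectral claims are read off from `f`.

Uniqueness of the measure: orthogonality fixes all moments, and these equal the moments of a measure
on `[-1, 1]`, for which the moment problem is determinate. -/

/-! ### Shifted factorials and the coefficients of `K_m` -/

lemma qPoch_zero (x q : ℝ) : qPoch x q 0 = 1 := by simp [qPoch]

lemma qPoch_succ (x q : ℝ) (n : ℕ) : qPoch x q (n + 1) = qPoch x q n * (1 - x * q ^ n) :=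
  Finset.prod_range_succ _ _

lemma qPoch_succ_left (x q : ℝ) (n : ℕ) :
    qPoch x q (n + 1) = (1 - x) * qPoch (x * q) q n := by
  rw [qPoch, Finset.prod_range_succ', mul_comm, qPoch]
  congr 1
  · simp
  · exact Finset.prod_congr rfl fun k _ => by ring

lemma qPoch_zero_left (q : ℝ) (n : ℕ) : qPoch 0 q n = 1 := by simp [qPoch]

lemma one_sub_pow_pos {q : ℝ} (hq0 : 0 < q) (hq1 : q < 1) (n : ℕ) : 0 < 1 - q ^ (n + 1) := by
  exact sub_pos.2 (pow_lt_one₀ hq0.le hq1 (Nat.succ_ne_zero n))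

lemma qPoch_self_pos {q : ℝ} (hq0 : 0 < q) (hq1 : q < 1) (n : ℕ) : 0 < qPoch q q n := by
  refine Finset.prod_pos fun k _ => ?_
  have := one_sub_pow_pos hq0 hq1 k
  rwa [pow_succ'] at this

lemma qPoch_neg_eq_zero {q : ℝ} (hq0 : 0 < q) {m k : ℕ} (h : m < k) :
    qPoch (q ^ (-(m : ℤ))) q k = 0 := by
  refine Finset.prod_eq_zero (Finset.mem_range.2 h) ?_
  have : q ^ m ≠ 0 := (pow_pos hq0 m).ne'
  simp [this]

/-- The coefficient of `x ^ k` in `K_m(x;a;q)`. -/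
def charlierCoeff (a q : ℝ) (m k : ℕ) : ℝ :=
  qPoch (q ^ (-(m : ℤ))) q k * qPoch (-a * q ^ m) q k / qPoch q q k * q ^ k

lemma charlierCoeff_zero (a q : ℝ) (m : ℕ) : charlierCoeff a q m 0 = 1 := by
  simp [charlierCoeff, qPoch_zero]

lemma charlierCoeff_eq_zero {a q : ℝ} (hq0 : 0 < q) {m k : ℕ} (h : m < k) :
    charlierCoeff a q m k = 0 := by
  rw [charlierCoeff, qPoch_neg_eq_zero hq0 h]
  simp

lemma altCharlier_eq_sum {a q : ℝ} (hq0 : 0 < q) {m N : ℕ} (h : m < N) (x : ℝ) :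
    altCharlier a q m x = ∑ k ∈ Finset.range N, charlierCoeff a q m k * x ^ k := by
  rw [altCharlier, phi21, tsum_eq_sum (s := Finset.range N)]
  · refine Finset.sum_congr rfl fun k _ => ?_
    rw [qPoch_zero_left, charlierCoeff, mul_pow]
    ring
  · intro k hk
    rw [qPoch_neg_eq_zero hq0 (by simp at hk; omega)]
    simp

lemma altCharlier_zero {a q : ℝ} (hq0 : 0 < q) (x : ℝ) : altCharlier a q 0 x = 1 := by
  rw [altCharlier_eq_sum hq0 (Nat.lt_succ_self 0)]
  simp [charlierCoeff_zero]

lemma continuous_altCharlier {a q : ℝ} (hq0 : 0 < q) (m : ℕ) :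
    Continuous (altCharlier a q m) := by
  rw [show altCharlier a q m = _ from funext (altCharlier_eq_sum hq0 (Nat.lt_succ_self m))]
  fun_prop

/-! ### The three-term recurrence -/

/-- The coefficient of `-K_{m+1}` in the expansion of `x K_m`. -/
def raiseCoeff (a q : ℝ) (m : ℕ) : ℝ :=
  q ^ m * (1 + a * q ^ m) / ((1 + a * q ^ (2 * m)) * (1 + a * q ^ (2 * m + 1)))

/-- The coefficient of `-K_m` in the expansion of `x K_{m+1}`. -/
def lowerCoeff (a q : ℝ) (m : ℕ) : ℝ :=
  a * q ^ (2 * m + 1) * (1 - q ^ (m + 1)) /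
    ((1 + a * q ^ (2 * m + 1)) * (1 + a * q ^ (2 * m + 2)))

lemma raiseCoeff_pos {a q : ℝ} (hq0 : 0 < q) (ha : 0 < a) (m : ℕ) : 0 < raiseCoeff a q m := by
  unfold raiseCoeff; positivity

lemma lowerCoeff_pos {a q : ℝ} (hq0 : 0 < q) (hq1 : q < 1) (ha : 0 < a) (m : ℕ) :
    0 < lowerCoeff a q m := by
  have := one_sub_pow_pos hq0 hq1 m
  unfold lowerCoeff; positivity

lemma diag_zero (a q : ℝ) : diag a q 0 = raiseCoeff a q 0 := by
  simp [diag, raiseCoeff]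

/-- This shape is forced by `K_m(0) = 1`: at `x = 0` the three coefficients of the recurrence must
sum to zero. -/
lemma diag_succ (a q : ℝ) (m : ℕ) :
    diag a q (m + 1) = raiseCoeff a q (m + 1) + lowerCoeff a q m := by
  have h1 : ((m + 1 : ℕ) : ℤ) - 1 = (m : ℕ) := by push_cast; ring
  have h2 : 2 * ((m + 1 : ℕ) : ℤ) - 1 = (2 * m + 1 : ℕ) := by push_cast; ring
  have h3 : 2 * ((m + 1 : ℕ) : ℤ) = (2 * m + 2 : ℕ) := by push_cast; ring
  rw [diag, raiseCoeff, lowerCoeff, h1, h2]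
  simp only [zpow_natCast]
  have e2 : 2 * (m + 1) = 2 * m + 2 := by ring
  rw [e2, mul_add, ← mul_div_assoc]
  congr 1
  rw [show 2 * m + 1 = m + (m + 1) by ring, pow_add q m (m + 1)]
  ring

lemma charlierCoeff_rec_zero {a q : ℝ} (hq0 : 0 < q) (hq1 : q < 1) (ha : 0 < a) (k : ℕ) :
    charlierCoeff a q 0 k = -raiseCoeff a q 0 * charlierCoeff a q 1 (k + 1) +
      raiseCoeff a q 0 * charlierCoeff a q 0 (k + 1) := by
  rcases k with _ | k
  · have h := one_sub_pow_pos hq0 hq1 0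
    have h1 : 1 + a ≠ 0 := by positivity
    have h2 : 1 + a * q ≠ 0 := by positivity
    have h3 : 1 - q ≠ 0 := by simpa using h.ne'
    simp [charlierCoeff, raiseCoeff, qPoch_succ, qPoch_zero]
    field_simp
    ring
  · rw [charlierCoeff_eq_zero hq0 (by omega), charlierCoeff_eq_zero hq0 (by omega),
      charlierCoeff_eq_zero hq0 (by omega)]
    ring

/-- The recurrence compared at `x^{k+1}`. All shifted factorials reduce to the two of length `k`
with bases `q^{-(m+1)}` and `-a q^{m+1}`; a rational identity in `q^m`, `q^k`, `a`, `q` remains. -/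
lemma charlierCoeff_rec_succ {a q : ℝ} (hq0 : 0 < q) (hq1 : q < 1) (ha : 0 < a) (m k : ℕ) :
    charlierCoeff a q (m + 1) k = -raiseCoeff a q (m + 1) * charlierCoeff a q (m + 2) (k + 1) +
      diag a q (m + 1) * charlierCoeff a q (m + 1) (k + 1) -
        lowerCoeff a q m * charlierCoeff a q m (k + 1) := by
  have hu := one_sub_pow_pos hq0 hq1 m
  have hk := one_sub_pow_pos hq0 hq1 k
  have hQ := qPoch_self_pos hq0 hq1 k
  have hv : 0 < q ^ m := pow_pos hq0 m
  have hy : 0 < q ^ k := pow_pos hq0 k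
  have z1 : q ^ (-((m + 1 : ℕ) : ℤ)) = (q ^ m * q)⁻¹ := by
    rw [zpow_neg, zpow_natCast, pow_succ]
  have z2 : q ^ (-((m + 2 : ℕ) : ℤ)) = (q ^ m * q * q)⁻¹ := by
    rw [zpow_neg, zpow_natCast, pow_succ, pow_succ]
  have z0 : q ^ (-(m : ℤ)) = (q ^ m)⁻¹ := by rw [zpow_neg, zpow_natCast]
  have f2 := qPoch_succ_left (q ^ m * q * q)⁻¹ q k
  have f1 := qPoch_succ (q ^ m * q)⁻¹ q k
  have f0 : (1 - (q ^ m * q)⁻¹) * qPoch (q ^ m)⁻¹ q (k + 1) =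
      qPoch (q ^ m * q)⁻¹ q k * (1 - (q ^ m * q)⁻¹ * q ^ k) *
        (1 - (q ^ m * q)⁻¹ * q ^ (k + 1)) := by
    rw [← qPoch_succ, ← qPoch_succ, qPoch_succ_left (q ^ m * q)⁻¹]
    congr 2
    field_simp
  have g2 : (1 + a * (q ^ m * q)) * qPoch (-a * (q ^ m * q * q)) q (k + 1) =
      qPoch (-a * (q ^ m * q)) q k * (1 - -a * (q ^ m * q) * q ^ k) *
        (1 - -a * (q ^ m * q) * q ^ (k + 1)) := by
    rw [← qPoch_succ, ← qPoch_succ, qPoch_succ_left (-a * (q ^ m * q))]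
    congr 2
    · ring
    · ring_nf
  have g1 := qPoch_succ (-a * (q ^ m * q)) q k
  have g0 := qPoch_succ_left (-a * q ^ m) q k
  rw [show (q ^ m * q * q)⁻¹ * q = (q ^ m * q)⁻¹ by field_simp] at f2
  rw [show -a * q ^ m * q = -a * (q ^ m * q) by ring] at g0
  rw [diag_succ]
  simp only [charlierCoeff, raiseCoeff, lowerCoeff, z0, z1, z2]
  rw [pow_succ q (m + 1), pow_succ q m, qPoch_succ q q k]
  rw [show 2 * (m + 1) + 1 = m + m + 3 by ring, show 2 * (m + 1) = m + m + 2 by ring,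
    show 2 * m + 1 = m + m + 1 by ring, show 2 * m + 2 = m + m + 2 by ring]
  simp only [pow_add q (m + m), pow_add q m m, pow_succ q k] at *
  rw [pow_succ] at hu
  have hk' : 0 < 1 - q * q ^ k := by linarith
  clear z0 z1 z2 hk
  have hu' : 1 - (q ^ m * q)⁻¹ ≠ 0 := by
    intro h
    rw [sub_eq_zero, eq_comm, inv_eq_one] at h
    linarith
  have hg : 1 + a * (q ^ m * q) ≠ 0 := by positivity
  rw [mul_comm, ← eq_div_iff hu'] at f0
  rw [mul_comm, ← eq_div_iff hg] at g2
  rw [f2, f1, f0, g2, g1, g0]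
  generalize qPoch (q ^ m * q)⁻¹ q k = F
  generalize qPoch (-a * (q ^ m * q)) q k = G
  generalize qPoch q q k = Q at *
  generalize q ^ m = v at *
  generalize q ^ k = y at *
  have hu2 : v * q - 1 ≠ 0 := by linarith
  have hu3 : 1 - v * q ≠ 0 := by linarith
  rw [show 1 - (v * q)⁻¹ = (v * q - 1) / (v * q) by field_simp]
  have n1 : 1 + a * (v * v * q ^ 2) ≠ 0 := by positivity
  have n2 : 1 + a * (v * v * q ^ 3) ≠ 0 := by positivity
  have n3 : 1 + a * (v * v * q ^ 1) ≠ 0 := by positivity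
  have n4 : 1 - y * q ≠ 0 := by rw [mul_comm]; exact hk'.ne'
  rw [mul_comm q y]
  have n5 := hQ.ne'
  field_simp
  ring

lemma mul_altCharlier_zero {a q : ℝ} (hq0 : 0 < q) (hq1 : q < 1) (ha : 0 < a) (x : ℝ) :
    x * altCharlier a q 0 x = -raiseCoeff a q 0 * altCharlier a q 1 x +
      diag a q 0 * altCharlier a q 0 x := by
  rw [altCharlier_eq_sum hq0 (N := 1) (m := 0) (by omega),
    altCharlier_eq_sum hq0 (N := 2) (m := 1) (by omega), diag_zero]
  have h := charlierCoeff_rec_zero hq0 hq1 ha 0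
  have h0 : charlierCoeff a q 0 1 = 0 := charlierCoeff_eq_zero hq0 (by omega)
  simp only [Finset.sum_range_succ, Finset.sum_range_zero, charlierCoeff_zero] at *
  rw [zero_add] at h
  rw [h0] at h
  linear_combination x * h

lemma mul_altCharlier_succ {a q : ℝ} (hq0 : 0 < q) (hq1 : q < 1) (ha : 0 < a) (m : ℕ) (x : ℝ) :
    x * altCharlier a q (m + 1) x = -raiseCoeff a q (m + 1) * altCharlier a q (m + 2) x +
      diag a q (m + 1) * altCharlier a q (m + 1) x - lowerCoeff a q m * altCharlier a q m x := by
  -- The right-hand sums get one index more than the left-hand one, so that splitting off their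
  -- constant terms leaves equal ranges.
  rw [altCharlier_eq_sum hq0 (m := m + 2) (N := m + 3 + 1) (by omega)]
  rw [altCharlier_eq_sum hq0 (m := m) (N := m + 3 + 1) (by omega)]
  nth_rw 2 [altCharlier_eq_sum hq0 (m := m + 1) (N := m + 3 + 1) (by omega)]
  rw [altCharlier_eq_sum hq0 (m := m + 1) (N := m + 3) (by omega)]
  simp only [Finset.sum_range_succ' _ (m + 3), charlierCoeff_zero, mul_add, Finset.mul_sum]
  rw [diag_succ]
  have : ∀ A B C : ℝ, ∀ f g h : ℕ → ℝ, (∑ i ∈ Finset.range (m + 3), f i + A) +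
      (∑ i ∈ Finset.range (m + 3), g i + B) - (∑ i ∈ Finset.range (m + 3), h i + C) =
      ∑ i ∈ Finset.range (m + 3), (f i + g i - h i) + (A + B - C) := by
    intro A B C f g h
    rw [Finset.sum_sub_distrib, Finset.sum_add_distrib]
    ring
  rw [this]
  rw [show ∀ y : ℝ, -raiseCoeff a q (m + 1) * (1 * y) + (raiseCoeff a q (m + 1) +
    lowerCoeff a q m) * (1 * y) - lowerCoeff a q m * (1 * y) = 0 from fun y => by ring, add_zero]
  refine Finset.sum_congr rfl fun k _ => ?_
  rw [charlierCoeff_rec_succ hq0 hq1 ha m k, diag_succ]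
  ring

/-! ### The weights and their moments -/

lemma weight_pos {a q : ℝ} (hq0 : 0 < q) (hq1 : q < 1) (ha : 0 < a) (n : ℕ) :
    0 < weight a q n := by
  have := qPoch_self_pos hq0 hq1 n
  unfold weight; positivity

lemma weight_zero (a q : ℝ) : weight a q 0 = 1 := by simp [weight, qPoch_zero]

lemma triangle_succ (n : ℕ) : (n + 1) * (n + 1 + 1) / 2 = n * (n + 1) / 2 + (n + 1) := by
  rw [show (n + 1) * (n + 1 + 1) = n * (n + 1) + (n + 1) * 2 by ring,
    Nat.add_mul_div_right _ _ two_pos]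

lemma weight_succ {a q : ℝ} (hq0 : 0 < q) (hq1 : q < 1) (n : ℕ) :
    weight a q (n + 1) * (1 - q ^ (n + 1)) = a * q ^ (n + 1) * weight a q n := by
  have h1 := (one_sub_pow_pos hq0 hq1 n).ne'
  have h2 := (qPoch_self_pos hq0 hq1 n).ne'
  rw [weight, weight, qPoch_succ, triangle_succ, pow_add q (n * (n + 1) / 2),
    ← pow_succ' q n, pow_succ' a n]
  field_simp

lemma tendsto_pow_succ {q : ℝ} (hq0 : 0 < q) (hq1 : q < 1) :
    Tendsto (fun n : ℕ => q ^ (n + 1)) atTop (𝓝 0) :=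
  (tendsto_add_atTop_iff_nat 1).2 (tendsto_pow_atTop_nhds_zero_of_lt_one hq0.le hq1)

lemma summable_weight {a q : ℝ} (hq0 : 0 < q) (hq1 : q < 1) (ha : 0 < a) :
    Summable (weight a q) := by
  refine summable_of_ratio_test_tendsto_lt_one (l := a * 0 / (1 - 0)) (by simp)
    (Eventually.of_forall fun n => (weight_pos hq0 hq1 ha n).ne') ?_
  have ht := tendsto_pow_succ hq0 hq1
  refine Tendsto.congr (fun n => ?_)
    ((ht.const_mul a).div (ht.const_sub 1) (by simp))
  have h1 := (one_sub_pow_pos hq0 hq1 n).ne'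
  have h0 := weight_pos hq0 hq1 ha n
  rw [Real.norm_of_nonneg h0.le, Real.norm_of_nonneg (weight_pos hq0 hq1 ha (n + 1)).le,
    Pi.div_apply, div_eq_div_iff h1 h0.ne', weight_succ hq0 hq1]

lemma pow_mem_unit {q : ℝ} (hq0 : 0 < q) (hq1 : q < 1) (n : ℕ) : q ^ n ∈ Set.Icc (0 : ℝ) 1 :=
  ⟨(pow_pos hq0 n).le, pow_le_one₀ hq0.le hq1.le⟩

lemma summable_weight_mul {a q : ℝ} (hq0 : 0 < q) (hq1 : q < 1) (ha : 0 < a) {f : ℝ → ℝ}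
    (hf : Continuous f) : Summable fun n => weight a q n * f (q ^ n) := by
  obtain ⟨C, hC⟩ := isCompact_Icc.exists_bound_of_continuousOn (s := Set.Icc (0 : ℝ) 1)
    hf.continuousOn
  refine Summable.of_norm_bounded ((summable_weight hq0 hq1 ha).mul_right C) fun n => ?_
  rw [norm_mul, Real.norm_of_nonneg (weight_pos hq0 hq1 ha n).le]
  exact mul_le_mul_of_nonneg_left (hC _ (pow_mem_unit hq0 hq1 n)) (weight_pos hq0 hq1 ha n).le

lemma multipliable_qPochInf {q : ℝ} (hq0 : 0 < q) (hq1 : q < 1) (x : ℝ) :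
    Multipliable fun k : ℕ => (1 - x * q ^ k) := by
  simpa [sub_eq_add_neg] using Real.multipliable_one_add_of_summable
    ((summable_geometric_of_lt_one hq0.le hq1).mul_left (-x))

lemma tendsto_qPoch {q : ℝ} (hq0 : 0 < q) (hq1 : q < 1) (x : ℝ) :
    Tendsto (qPoch x q) atTop (𝓝 (qPochInf x q)) :=
  (multipliable_qPochInf hq0 hq1 x).hasProd.tendsto_prod_nat

lemma qPochInf_eq {q : ℝ} (hq0 : 0 < q) (hq1 : q < 1) (x : ℝ) :
    qPochInf x q = (1 - x) * qPochInf (x * q) q := by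
  refine tendsto_nhds_unique ((tendsto_add_atTop_iff_nat 1).2 (tendsto_qPoch hq0 hq1 x)) ?_
  simp only [qPoch_succ_left]
  exact (tendsto_qPoch hq0 hq1 (x * q)).const_mul _

/-- The moment `∑ₙ wₙ q^{nk}` of the weights. -/
def moment (a q : ℝ) (k : ℕ) : ℝ := ∑' n, weight a q n * (q ^ n) ^ k

/-- The difference of the two moments carries the factor `1 - q^n`, which kills the term `n = 0`;
`weight_succ` turns the shifted remainder into a multiple of the next moment. -/
lemma moment_eq {a q : ℝ} (hq0 : 0 < q) (hq1 : q < 1) (ha : 0 < a) (k : ℕ) :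
    moment a q k = (1 + a * q ^ (k + 1)) * moment a q (k + 1) := by
  have s0 := summable_weight_mul hq0 hq1 ha (continuous_pow k)
  have s1 := summable_weight_mul hq0 hq1 ha (continuous_pow (k + 1))
  have h : moment a q k - moment a q (k + 1) = a * q ^ (k + 1) * moment a q (k + 1) := by
    rw [moment, moment, ← s0.tsum_sub s1, (s0.sub s1).tsum_eq_zero_add, ← tsum_mul_left]
    simp only [pow_zero, one_pow, sub_self, zero_add]
    refine tsum_congr fun n => ?_
    have := weight_succ (a := a) hq0 hq1 n
    have e : (q ^ (n + 1)) ^ k = (q ^ n) ^ k * q ^ k := by rw [pow_succ, mul_pow]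
    rw [pow_succ (q ^ (n + 1)) k, e, pow_succ q k, pow_succ (q ^ n) k]
    rw [pow_succ q n] at *
    linear_combination (q ^ n) ^ k * q ^ k * this
  linarith

lemma tendsto_moment {a q : ℝ} (hq0 : 0 < q) (hq1 : q < 1) (ha : 0 < a) :
    Tendsto (moment a q) atTop (𝓝 1) := by
  have h := tendsto_tsum_of_dominated_convergence (𝓕 := atTop)
    (f := fun k n => weight a q n * (q ^ n) ^ k) (g := fun n => if n = 0 then 1 else 0)
    (summable_weight hq0 hq1 ha) (fun n => ?_) (Eventually.of_forall fun k n => ?_)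
  · simpa [tsum_ite_eq] using! h
  · rcases n with _ | n
    · simp [weight_zero]
    · simpa using (tendsto_pow_atTop_nhds_zero_of_lt_one (pow_pos hq0 (n + 1)).le
        (pow_lt_one₀ hq0.le hq1 (Nat.succ_ne_zero n))).const_mul (weight a q (n + 1))
  · have hw := weight_pos hq0 hq1 ha n
    have hp := pow_mem_unit hq0 hq1 n
    rw [norm_mul, Real.norm_of_nonneg hw.le, Real.norm_of_nonneg (pow_nonneg hp.1 k)]
    exact mul_le_of_le_one_right hw.le (pow_le_one₀ hp.1 hp.2)

/-- Euler's identity: `(-aq;q)_k` times the `k`-th moment does not depend on `k`, and the moments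
tend to `w_0 = 1`. -/
lemma moment_zero {a q : ℝ} (hq0 : 0 < q) (hq1 : q < 1) (ha : 0 < a) :
    moment a q 0 = qPochInf (-a * q) q := by
  have h : ∀ k, qPoch (-a * q) q k * moment a q k = moment a q 0 := by
    intro k
    induction k with
    | zero => simp [qPoch_zero]
    | succ k ih =>
      rw [← ih, moment_eq hq0 hq1 ha k, qPoch_succ]
      ring
  refine tendsto_nhds_unique (tendsto_const_nhds (f := (atTop : Filter ℕ))) ?_
  have := (tendsto_qPoch hq0 hq1 (-a * q)).mul (tendsto_moment hq0 hq1 ha)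
  simpa only [h, mul_one] using this

/-! ### Orthogonality of the `K_m` -/

/-- `K_m` as a continuous function. -/
def charlierMap (a : ℝ) {q : ℝ} (hq0 : 0 < q) (m : ℕ) : C(ℝ, ℝ) :=
  ⟨altCharlier a q m, continuous_altCharlier hq0 m⟩

/-- Summation against the weights, as a linear functional on continuous functions. -/
def weightSum {a q : ℝ} (hq0 : 0 < q) (hq1 : q < 1) (ha : 0 < a) : C(ℝ, ℝ) →ₗ[ℝ] ℝ where
  toFun f := ∑' n, weight a q n * f (q ^ n)
  map_add' f g := by
    rw [← (summable_weight_mul hq0 hq1 ha f.continuous).tsum_add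
      (summable_weight_mul hq0 hq1 ha g.continuous)]
    simp [mul_add]
  map_smul' c f := by
    rw [RingHom.id_apply, smul_eq_mul, ← tsum_mul_left]
    exact tsum_congr fun n => by simp; ring

lemma hasSum_weightSum {a q : ℝ} (hq0 : 0 < q) (hq1 : q < 1) (ha : 0 < a) (f : C(ℝ, ℝ)) :
    HasSum (fun n => weight a q n * f (q ^ n)) (weightSum hq0 hq1 ha f) :=
  (summable_weight_mul hq0 hq1 ha f.continuous).hasSum

lemma weightSum_pow {a q : ℝ} (hq0 : 0 < q) (hq1 : q < 1) (ha : 0 < a) (k : ℕ) :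
    weightSum hq0 hq1 ha (ContinuousMap.id ℝ ^ k) = moment a q k := rfl

lemma charlierMap_eq_sum (a : ℝ) {q : ℝ} (hq0 : 0 < q) {m N : ℕ} (h : m < N) :
    charlierMap a hq0 m =
      ∑ k ∈ Finset.range N, charlierCoeff a q m k • ContinuousMap.id ℝ ^ k := by
  ext x
  simpa [charlierMap] using altCharlier_eq_sum hq0 h x

lemma charlierMap_zero (a : ℝ) {q : ℝ} (hq0 : 0 < q) : charlierMap a hq0 0 = 1 := by
  ext x
  exact altCharlier_zero hq0 x

lemma id_mul_charlierMap_zero {a q : ℝ} (hq0 : 0 < q) (hq1 : q < 1) (ha : 0 < a) :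
    ContinuousMap.id ℝ * charlierMap a hq0 0 = -raiseCoeff a q 0 • charlierMap a hq0 1 +
      diag a q 0 • charlierMap a hq0 0 := by
  ext x
  exact mul_altCharlier_zero hq0 hq1 ha x

lemma id_mul_charlierMap_succ {a q : ℝ} (hq0 : 0 < q) (hq1 : q < 1) (ha : 0 < a) (m : ℕ) :
    ContinuousMap.id ℝ * charlierMap a hq0 (m + 1) =
      -raiseCoeff a q (m + 1) • charlierMap a hq0 (m + 2) +
      diag a q (m + 1) • charlierMap a hq0 (m + 1) - lowerCoeff a q m • charlierMap a hq0 m := by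
  ext x
  exact mul_altCharlier_succ hq0 hq1 ha m x

/-- The `q`-difference equation of `K_m` in coefficients: with `l_k = q^{-k} - a q^k`, `K_m` is an
eigenvector, for `l_m`, of the operator `D : x^k ↦ l_k x^k + (1 - q^{-k}) x^{k-1}`. -/
lemma charlierCoeff_succ {a q : ℝ} (hq0 : 0 < q) (hq1 : q < 1) (m k : ℕ) :
    charlierCoeff a q m (k + 1) * (1 - (q ^ (k + 1))⁻¹) =
      charlierCoeff a q m k * ((q ^ m)⁻¹ - a * q ^ m - ((q ^ k)⁻¹ - a * q ^ k)) := by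
  have h1 := (one_sub_pow_pos hq0 hq1 k).ne'
  have h2 := (qPoch_self_pos hq0 hq1 k).ne'
  have h3 : 1 - q ^ k * q ≠ 0 := by rwa [pow_succ] at h1
  have h4 : q ^ k * q - 1 ≠ 0 := by contrapose! h3; linarith
  rw [charlierCoeff, charlierCoeff, qPoch_succ, qPoch_succ, qPoch_succ, zpow_neg, zpow_natCast,
    pow_succ, mul_comm q (q ^ k)]
  field_simp
  ring

/-- By `moment_eq`, the functional `L` of summation against the weights satisfies `L ∘ D = l_0 L` on
polynomials, with `D` the operator of `charlierCoeff_succ`. Hence `(l_{m+1} - l_0) L(K_{m+1}) = 0`,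
and `l_{m+1} > l_0`. -/
lemma weightSum_charlierMap_succ {a q : ℝ} (hq0 : 0 < q) (hq1 : q < 1) (ha : 0 < a) (m : ℕ) :
    weightSum hq0 hq1 ha (charlierMap a hq0 (m + 1)) = 0 := by
  have hval : ∀ N, m + 1 < N → weightSum hq0 hq1 ha (charlierMap a hq0 (m + 1)) =
      ∑ k ∈ Finset.range N, charlierCoeff a q (m + 1) k * moment a q k := by
    intro N hN
    rw [charlierMap_eq_sum a hq0 hN, map_sum]
    exact Finset.sum_congr rfl fun k _ => by rw [map_smul, weightSum_pow, smul_eq_mul]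
  set c := charlierCoeff a q (m + 1) with hc
  set l : ℕ → ℝ := fun k => (q ^ k)⁻¹ - a * q ^ k with hl
  have e1 : ∀ k, c k * moment a q k * (l (m + 1) - l k) =
      c (k + 1) * moment a q (k + 1) * (l 0 - l (k + 1)) := by
    intro k
    have hq : q ^ (k + 1) ≠ 0 := (pow_pos hq0 _).ne'
    have h := charlierCoeff_succ (a := a) hq0 hq1 (m + 1) k
    have e2 : l 0 - l (k + 1) = (1 - (q ^ (k + 1))⁻¹) * (1 + a * q ^ (k + 1)) := by
      simp only [hl]
      field_simp
      ring
    rw [e2, moment_eq hq0 hq1 ha k]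
    linear_combination -(1 + a * q ^ (k + 1)) * moment a q (k + 1) * h
  -- The index shift adds no boundary terms: `l 0 - l k` vanishes at `k = 0`, and `c (m + 2) = 0`.
  have e3 : ∑ k ∈ Finset.range (m + 2), c k * moment a q k * (l (m + 1) - l k) =
      ∑ k ∈ Finset.range (m + 2 + 1), c k * moment a q k * (l 0 - l k) := by
    rw [Finset.sum_range_succ' _ (m + 2), sub_self, mul_zero, add_zero]
    exact Finset.sum_congr rfl fun k _ => e1 k
  have hz : c (m + 2) = 0 := charlierCoeff_eq_zero hq0 (by omega)
  rw [Finset.sum_range_succ _ (m + 2), hz, zero_mul, zero_mul, add_zero, ← sub_eq_zero,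
    ← Finset.sum_sub_distrib] at e3
  have e4 : (l (m + 1) - l 0) * weightSum hq0 hq1 ha (charlierMap a hq0 (m + 1)) = 0 := by
    rw [hval (m + 2) (by omega), Finset.mul_sum, ← e3]
    exact Finset.sum_congr rfl fun k _ => by ring
  refine (mul_eq_zero.1 e4).resolve_left (ne_of_gt ?_)
  have h1 : q ^ (m + 1) < 1 := by linarith [one_sub_pow_pos hq0 hq1 m]
  have h2 := (one_lt_inv₀ (pow_pos hq0 (m + 1))).2 h1
  have h3 : a * q ^ (m + 1) < a * 1 := mul_lt_mul_of_pos_left h1 ha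
  simp only [hl, pow_zero, inv_one]
  linarith

/-- Absorbing one factor `x` by the recurrence lowers `j` by one and the degree index by at most
one, so `j < m` persists. -/
lemma weightSum_pow_mul_charlierMap {a q : ℝ} (hq0 : 0 < q) (hq1 : q < 1) (ha : 0 < a) (j : ℕ) :
    ∀ m, j < m → weightSum hq0 hq1 ha (ContinuousMap.id ℝ ^ j * charlierMap a hq0 m) = 0 := by
  induction j with
  | zero =>
    rintro (_ | m) h
    · omega
    · rw [pow_zero, one_mul, weightSum_charlierMap_succ]
  | succ j ih =>
    rintro (_ | m) h
    · omega
    · rw [pow_succ, mul_assoc, id_mul_charlierMap_succ hq0 hq1 ha, mul_sub, mul_add]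
      simp only [mul_smul_comm, map_sub, map_add, map_smul]
      rw [ih _ (by omega), ih _ (by omega), ih _ (by omega)]
      simp

lemma weightSum_mul_of_lt {a q : ℝ} (hq0 : 0 < q) (hq1 : q < 1) (ha : 0 < a) {m n : ℕ}
    (h : m < n) :
    weightSum hq0 hq1 ha (charlierMap a hq0 m * charlierMap a hq0 n) = 0 := by
  rw [charlierMap_eq_sum a hq0 (Nat.lt_succ_self m), Finset.sum_mul, map_sum]
  refine Finset.sum_eq_zero fun k hk => ?_
  rw [Finset.mem_range] at hk
  rw [smul_mul_assoc, map_smul, weightSum_pow_mul_charlierMap hq0 hq1 ha k n (by omega), smul_zero]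

/-- The sum of `x K_m K_{m+1}` is computed twice, expanding `x K_m` or `x K_{m+1}`. -/
lemma raiseCoeff_mul_weightSum {a q : ℝ} (hq0 : 0 < q) (hq1 : q < 1) (ha : 0 < a) (m : ℕ) :
    raiseCoeff a q m *
        weightSum hq0 hq1 ha (charlierMap a hq0 (m + 1) * charlierMap a hq0 (m + 1)) =
      lowerCoeff a q m * weightSum hq0 hq1 ha (charlierMap a hq0 m * charlierMap a hq0 m) := by
  have z : ∀ {i j}, i < j →
      weightSum hq0 hq1 ha (charlierMap a hq0 i * charlierMap a hq0 j) = 0 :=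
    fun h => weightSum_mul_of_lt hq0 hq1 ha h
  have h1 : weightSum hq0 hq1 ha
      ((ContinuousMap.id ℝ * charlierMap a hq0 m) * charlierMap a hq0 (m + 1)) =
      -(raiseCoeff a q m *
        weightSum hq0 hq1 ha (charlierMap a hq0 (m + 1) * charlierMap a hq0 (m + 1))) := by
    rcases m with _ | m
    · rw [id_mul_charlierMap_zero hq0 hq1 ha, add_mul]
      simp only [smul_mul_assoc, map_add, map_smul, smul_eq_mul]
      rw [z (Nat.lt_succ_self 0)]
      ring
    · rw [id_mul_charlierMap_succ hq0 hq1 ha, sub_mul, add_mul]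
      simp only [smul_mul_assoc, map_sub, map_add, map_smul, smul_eq_mul]
      rw [z (show m + 1 < m + 1 + 1 by omega), z (show m < m + 1 + 1 by omega)]
      ring
  have h2 : weightSum hq0 hq1 ha
      (charlierMap a hq0 m * (ContinuousMap.id ℝ * charlierMap a hq0 (m + 1))) =
      -(lowerCoeff a q m *
        weightSum hq0 hq1 ha (charlierMap a hq0 m * charlierMap a hq0 m)) := by
    rw [id_mul_charlierMap_succ hq0 hq1 ha, mul_sub, mul_add]
    simp only [mul_smul_comm, map_sub, map_add, map_smul, smul_eq_mul]
    rw [z (show m < m + 1 by omega), z (show m < m + 2 by omega)]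
    ring
  rw [mul_comm (ContinuousMap.id ℝ), mul_assoc] at h1
  linarith

lemma normSq_zero {a q : ℝ} (hq0 : 0 < q) (hq1 : q < 1) (ha : 0 < a) :
    normSq a q 0 = qPochInf (-a * q) q := by
  have h := qPochInf_eq hq0 hq1 (-a)
  have : 1 + a ≠ 0 := by positivity
  simp only [normSq, pow_zero, mul_one, qPoch_zero, mul_zero, zero_mul, Nat.zero_div]
  rw [h, sub_neg_eq_add]
  field_simp

lemma raiseCoeff_mul_normSq {a q : ℝ} (hq0 : 0 < q) (hq1 : q < 1) (ha : 0 < a) (m : ℕ) :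
    raiseCoeff a q m * normSq a q (m + 1) = lowerCoeff a q m * normSq a q m := by
  have h := qPochInf_eq hq0 hq1 (-a * q ^ m)
  rw [show -a * q ^ m * q = -a * q ^ (m + 1) by ring,
    show 1 - -a * q ^ m = 1 + a * q ^ m by ring] at h
  rw [normSq, normSq, raiseCoeff, lowerCoeff, h, triangle_succ, pow_add q (m * (m + 1) / 2),
    qPoch_succ, show 2 * (m + 1) = 2 * m + 2 by ring, ← pow_succ' q m]
  have h0 : 1 + a * q ^ m ≠ 0 := by positivity
  have h1 : 1 + a * q ^ (2 * m) ≠ 0 := by positivity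
  have h2 : 1 + a * q ^ (2 * m + 1) ≠ 0 := by positivity
  have h3 : 1 + a * q ^ (2 * m + 2) ≠ 0 := by positivity
  field_simp
  ring

lemma weightSum_sq {a q : ℝ} (hq0 : 0 < q) (hq1 : q < 1) (ha : 0 < a) (m : ℕ) :
    weightSum hq0 hq1 ha (charlierMap a hq0 m * charlierMap a hq0 m) = normSq a q m := by
  induction m with
  | zero =>
    rw [charlierMap_zero, mul_one, normSq_zero hq0 hq1 ha, ← moment_zero hq0 hq1 ha,
      ← weightSum_pow hq0 hq1 ha, pow_zero]
  | succ m ih =>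
    have h1 := raiseCoeff_mul_weightSum hq0 hq1 ha m
    rw [ih, ← raiseCoeff_mul_normSq hq0 hq1 ha] at h1
    exact mul_left_cancel₀ (raiseCoeff_pos hq0 ha m).ne' h1

lemma weightSum_mul {a q : ℝ} (hq0 : 0 < q) (hq1 : q < 1) (ha : 0 < a) (m n : ℕ) :
    weightSum hq0 hq1 ha (charlierMap a hq0 m * charlierMap a hq0 n) =
      if m = n then normSq a q m else 0 := by
  rcases lt_trichotomy m n with h | rfl | h
  · rw [if_neg h.ne, weightSum_mul_of_lt hq0 hq1 ha h]
  · rw [if_pos rfl, weightSum_sq]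
  · rw [if_neg h.ne', mul_comm, weightSum_mul_of_lt hq0 hq1 ha h]

lemma hasSum_altCharlier_mul {a q : ℝ} (hq0 : 0 < q) (hq1 : q < 1) (ha : 0 < a) (m n : ℕ) :
    HasSum (fun k => weight a q k * altCharlier a q m (q ^ k) * altCharlier a q n (q ^ k))
      (if m = n then normSq a q m else 0) := by
  have h := hasSum_weightSum hq0 hq1 ha (charlierMap a hq0 m * charlierMap a hq0 n)
  rw [weightSum_mul] at h
  simpa [charlierMap, mul_assoc] using h

lemma moment_zero_pos {a q : ℝ} (hq0 : 0 < q) (hq1 : q < 1) (ha : 0 < a) : 0 < moment a q 0 := by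
  have hs := summable_weight_mul hq0 hq1 ha (continuous_pow 0)
  exact hs.tsum_pos (fun n => by simpa using (weight_pos hq0 hq1 ha n).le) 0
    (by simpa using weight_pos hq0 hq1 ha 0)

lemma normSq_pos {a q : ℝ} (hq0 : 0 < q) (hq1 : q < 1) (ha : 0 < a) (m : ℕ) :
    0 < normSq a q m := by
  induction m with
  | zero => rw [normSq_zero hq0 hq1 ha, ← moment_zero hq0 hq1 ha]; exact moment_zero_pos hq0 hq1 ha
  | succ m ih =>
    have h := mul_pos (lowerCoeff_pos hq0 hq1 ha m) ih
    rw [← raiseCoeff_mul_normSq hq0 hq1 ha] at h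
    exact pos_of_mul_pos_right h (raiseCoeff_pos hq0 ha m).le

lemma pow_mem_span_charlierMap {a q : ℝ} (hq0 : 0 < q) (hq1 : q < 1) (ha : 0 < a) (k : ℕ) :
    ContinuousMap.id ℝ ^ k ∈ Submodule.span ℝ (Set.range (charlierMap a hq0)) := by
  have hK : ∀ m, charlierMap a hq0 m ∈ Submodule.span ℝ (Set.range (charlierMap a hq0)) :=
    fun m => Submodule.subset_span ⟨m, rfl⟩
  induction k with
  | zero => rw [pow_zero, ← charlierMap_zero a hq0]; exact hK 0
  | succ k ih =>
    rw [pow_succ']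
    generalize ContinuousMap.id ℝ ^ k = f at ih
    induction ih using Submodule.span_induction with
    | mem x hx =>
      obtain ⟨m, rfl⟩ := hx
      rcases m with _ | m
      · rw [id_mul_charlierMap_zero hq0 hq1 ha]
        exact add_mem (Submodule.smul_mem _ _ (hK _)) (Submodule.smul_mem _ _ (hK _))
      · rw [id_mul_charlierMap_succ hq0 hq1 ha]
        exact sub_mem (add_mem (Submodule.smul_mem _ _ (hK _)) (Submodule.smul_mem _ _ (hK _)))
          (Submodule.smul_mem _ _ (hK _))
    | zero => simp
    | add x y _ _ hx hy => rw [mul_add]; exact add_mem hx hy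
    | smul c x _ hx => rw [mul_smul_comm]; exact Submodule.smul_mem _ _ hx

/-! ### Determinacy of the moment problem -/

/-- Markov's inequality for `x^{2k}`: mass of `μ` on `|x| ≥ c > 1` would make the even moments grow
like `c^{2k}`, while those of `ν` stay bounded. -/
lemma ae_abs_le_one_of_integral_pow_eq {μ ν : Measure ℝ} [IsFiniteMeasure μ] [IsFiniteMeasure ν]
    (hν : ∀ᵐ x ∂ν, |x| ≤ 1) (hi : ∀ k : ℕ, Integrable (fun x => x ^ k) μ)
    (h : ∀ k : ℕ, ∫ x, x ^ k ∂μ = ∫ x, x ^ k ∂ν) : ∀ᵐ x ∂μ, |x| ≤ 1 := by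
  have key : ∀ c : ℝ, 1 < c → ∀ᵐ x ∂μ, ¬ c ≤ |x| := by
    intro c hc
    have hc0 : 0 < c := zero_lt_one.trans hc
    have hb : ∀ k : ℕ, μ.real {x | c ≤ |x|} ≤ ((c ^ 2)⁻¹) ^ k * ν.real Set.univ := by
      intro k
      have h1 : (c ^ 2) ^ k * μ.real {x : ℝ | (c ^ 2) ^ k ≤ x ^ (2 * k)} ≤ ∫ x, x ^ (2 * k) ∂μ :=
        mul_meas_ge_le_integral_of_nonneg
          (Eventually.of_forall fun x => (even_two_mul k).pow_nonneg x) (hi _) _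
      have h2 : ∫ x, x ^ (2 * k) ∂ν ≤ 1 * ν.real Set.univ := by
        refine (Real.le_norm_self _).trans (norm_integral_le_of_norm_le_const ?_)
        filter_upwards [hν] with x hx
        rw [norm_pow, Real.norm_eq_abs]
        exact pow_le_one₀ (abs_nonneg x) hx
      have h3 : μ.real {x : ℝ | c ≤ |x|} ≤ μ.real {x : ℝ | (c ^ 2) ^ k ≤ x ^ (2 * k)} := by
        refine measureReal_mono fun x hx => ?_
        have : c ^ 2 ≤ x ^ 2 := by rw [← sq_abs x]; exact pow_le_pow_left₀ hc0.le hx 2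
        rw [Set.mem_ofPred_eq, pow_mul]
        exact pow_le_pow_left₀ (by positivity) this k
      rw [inv_pow, ← div_eq_inv_mul, le_div_iff₀ (by positivity), mul_comm]
      rw [h, one_mul] at *
      exact (mul_le_mul_of_nonneg_left h3 (by positivity)).trans (h1.trans h2)
    have ht : Tendsto (fun k : ℕ => ((c ^ 2)⁻¹) ^ k * ν.real Set.univ) atTop (𝓝 0) := by
      simpa using (tendsto_pow_atTop_nhds_zero_of_lt_one (by positivity)
        (inv_lt_one_of_one_lt₀ (one_lt_pow₀ hc two_ne_zero))).mul_const (ν.real Set.univ)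
    have h0 : μ.real {x | c ≤ |x|} = 0 :=
      le_antisymm (ge_of_tendsto' ht hb) measureReal_nonneg
    rw [measureReal_eq_zero_iff] at h0
    rw [ae_iff]
    simpa using h0
  have hall : ∀ᵐ x ∂μ, ∀ n : ℕ, ¬ (1 + 1 / ((n : ℝ) + 1)) ≤ |x| :=
    ae_all_iff.2 fun n => key _ (by have : (0 : ℝ) < 1 / ((n : ℝ) + 1) := by positivity
                                    linarith)
  filter_upwards [hall] with x hx
  by_contra! hlt
  obtain ⟨n, hn⟩ := exists_nat_one_div_lt (sub_pos.2 hlt)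
  exact hx n (by linarith)

lemma integral_eval_eq {μ ν : Measure ℝ} (hμ : ∀ k : ℕ, Integrable (fun x => x ^ k) μ)
    (hν : ∀ k : ℕ, Integrable (fun x => x ^ k) ν)
    (h : ∀ k : ℕ, ∫ x, x ^ k ∂μ = ∫ x, x ^ k ∂ν) (p : Polynomial ℝ) :
    ∫ x, p.eval x ∂μ = ∫ x, p.eval x ∂ν := by
  simp only [Polynomial.eval_eq_sum_range]
  rw [integral_finsetSum _ fun k _ => (hμ k).const_mul _,
    integral_finsetSum _ fun k _ => (hν k).const_mul _]
  exact Finset.sum_congr rfl fun k _ => by rw [integral_const_mul, integral_const_mul, h]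

lemma integrable_eval {μ : Measure ℝ} (hμ : ∀ k : ℕ, Integrable (fun x => x ^ k) μ)
    (p : Polynomial ℝ) : Integrable (fun x => p.eval x) μ := by
  simp only [Polynomial.eval_eq_sum_range]
  exact integrable_finsetSum _ fun k _ => (hμ k).const_mul _

/-- The moment problem is determinate for measures on `[-1, 1]`. -/
lemma ext_of_integral_pow_eq {μ ν : Measure ℝ} [IsFiniteMeasure μ] [IsFiniteMeasure ν]
    (hν : ∀ᵐ x ∂ν, |x| ≤ 1) (hi : ∀ k : ℕ, Integrable (fun x => x ^ k) μ)
    (hiν : ∀ k : ℕ, Integrable (fun x => x ^ k) ν)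
    (h : ∀ k : ℕ, ∫ x, x ^ k ∂μ = ∫ x, x ^ k ∂ν) : μ = ν := by
  have hμ := ae_abs_le_one_of_integral_pow_eq hν hi h
  refine ext_of_forall_integral_eq_of_IsFiniteMeasure fun f => ?_
  have approx : ∀ (ρ : Measure ℝ) [IsFiniteMeasure ρ], (∀ᵐ x ∂ρ, |x| ≤ 1) →
      (∀ k : ℕ, Integrable (fun x => x ^ k) ρ) → ∀ (p : Polynomial ℝ) (ε : ℝ),
      (∀ x ∈ Set.Icc (-1 : ℝ) 1, |p.eval x - f x| < ε) →
      |∫ x, p.eval x ∂ρ - ∫ x, f x ∂ρ| ≤ ε * ρ.real Set.univ := by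
    intro ρ _ hρ hk p ε hp
    rw [← integral_sub (integrable_eval hk p) (f.integrable ρ), ← Real.norm_eq_abs]
    refine norm_integral_le_of_norm_le_const (μ := ρ) ?_
    filter_upwards [hρ] with x hx
    exact (hp x (abs_le.1 hx)).le
  refine eq_of_abs_sub_le_all fun δ hδ => ?_
  -- A uniform error `δ / M` costs at most `δ` over both measures; the summand `1` keeps `M`
  -- positive.
  set M := μ.real Set.univ + ν.real Set.univ + 1 with hM
  have hM0 : 0 < M := by positivity
  obtain ⟨p, hp⟩ := exists_polynomial_near_of_continuousOn (-1) 1 f f.continuous.continuousOn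
    (δ / M) (by positivity)
  have h1 := approx μ hμ hi p _ hp
  have h2 := approx ν hν hiν p _ hp
  rw [integral_eval_eq hi hiν h p] at h1
  have h3 : δ / M * μ.real Set.univ + δ / M * ν.real Set.univ ≤ δ := by
    have e : δ / M * M = δ := div_mul_cancel₀ _ hM0.ne'
    have : 0 ≤ δ / M := by positivity
    rw [hM, mul_add, mul_add, mul_one, ← hM] at e
    linarith
  rw [abs_sub_comm] at h1
  have h4 := abs_sub_le (∫ x, f x ∂μ) (∫ x, p.eval x ∂ν) (∫ x, f x ∂ν)
  linarith

variable {a q : ℝ}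

lemma integral_smul_dirac (hq0 : 0 < q) (hq1 : q < 1) (ha : 0 < a) (f : ℝ → ℝ) (n : ℕ) :
    ∫ x, f x ∂(ENNReal.ofReal (weight a q n) • Measure.dirac (q ^ n)) =
      weight a q n * f (q ^ n) := by
  rw [integral_smul_measure, integral_dirac,
    ENNReal.toReal_ofReal (weight_pos hq0 hq1 ha n).le, smul_eq_mul]

lemma integrable_discreteMeasure (hq0 : 0 < q) (hq1 : q < 1) (ha : 0 < a) (f : C(ℝ, ℝ)) :
    Integrable f (discreteMeasure a q) := by
  refine integrable_sum_measure
    (fun n => (integrable_dirac (by simp)).smul_measure ENNReal.ofReal_ne_top) ?_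
  simp only [integral_smul_dirac hq0 hq1 ha (fun x => ‖f x‖)]
  exact summable_weight_mul hq0 hq1 ha f.continuous.norm

lemma integral_discreteMeasure (hq0 : 0 < q) (hq1 : q < 1) (ha : 0 < a) (f : C(ℝ, ℝ)) :
    ∫ x, f x ∂discreteMeasure a q = weightSum hq0 hq1 ha f := by
  have h := hasSum_integral_measure (integrable_discreteMeasure hq0 hq1 ha f)
  simp only [integral_smul_dirac hq0 hq1 ha f] at h
  exact h.unique (hasSum_weightSum hq0 hq1 ha f)

lemma ae_discreteMeasure_abs_le_one (hq0 : 0 < q) (hq1 : q < 1) :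
    ∀ᵐ x ∂discreteMeasure a q, |x| ≤ 1 := by
  rw [discreteMeasure, Measure.ae_sum_iff]
  refine fun n => Measure.ae_smul_measure ?_ _
  have := pow_mem_unit hq0 hq1 n
  rw [ae_dirac_eq]
  exact abs_le.2 ⟨by linarith [this.1], this.2⟩

lemma isOrthogonalityMeasure_discreteMeasure (hq0 : 0 < q) (hq1 : q < 1) (ha : 0 < a) :
    IsOrthogonalityMeasure a q (discreteMeasure a q) := fun m n =>
  ⟨integrable_discreteMeasure hq0 hq1 ha (charlierMap a hq0 m * charlierMap a hq0 n),
    (integral_discreteMeasure hq0 hq1 ha (charlierMap a hq0 m * charlierMap a hq0 n)).trans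
      (weightSum_mul hq0 hq1 ha m n)⟩

/-- As `K_0 = 1`, the relations with `m' = 0` already fix the integral of each `K_m`, hence of their
span. -/
lemma IsOrthogonalityMeasure.integral_eq {μ : Measure ℝ} (hμ : IsOrthogonalityMeasure a q μ)
    (hq0 : 0 < q) (hq1 : q < 1) (ha : 0 < a) {f : C(ℝ, ℝ)}
    (hf : f ∈ Submodule.span ℝ (Set.range (charlierMap a hq0))) :
    Integrable f μ ∧ ∫ x, f x ∂μ = weightSum hq0 hq1 ha f := by
  induction hf using Submodule.span_induction with
  | mem x hx =>
    obtain ⟨m, rfl⟩ := hx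
    have h1 : ∀ x, charlierMap a hq0 m x = altCharlier a q m x * altCharlier a q 0 x := fun x => by
      rw [altCharlier_zero hq0, mul_one]; rfl
    have h2 := weightSum_mul hq0 hq1 ha m 0
    rw [charlierMap_zero, mul_one] at h2
    rw [h2, show (charlierMap a hq0 m : ℝ → ℝ) = _ from funext h1]
    exact hμ m 0
  | zero => simp
  | add f g _ _ hf hg =>
    refine ⟨hf.1.add hg.1, ?_⟩
    rw [map_add, ← hf.2, ← hg.2, ← integral_add hf.1 hg.1]
    rfl
  | smul c f _ hf =>
    refine ⟨hf.1.smul c, ?_⟩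
    rw [map_smul, ← hf.2, ← integral_smul]
    rfl

lemma isFiniteMeasure_of_integrable_pow {μ : Measure ℝ}
    (h : ∀ k : ℕ, Integrable (fun x => x ^ k) μ) : IsFiniteMeasure μ := by
  have := h 0
  simp only [pow_zero] at this
  rw [integrable_const_iff] at this
  simpa using this

lemma isOrthogonalityMeasure_iff (hq0 : 0 < q) (hq1 : q < 1) (ha : 0 < a) (μ : Measure ℝ) :
    IsOrthogonalityMeasure a q μ ↔ μ = discreteMeasure a q := by
  refine ⟨fun hμ => ?_, fun h => h ▸ isOrthogonalityMeasure_discreteMeasure hq0 hq1 ha⟩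
  have hν := isOrthogonalityMeasure_discreteMeasure hq0 hq1 ha
  have h1 := fun k => hμ.integral_eq hq0 hq1 ha (pow_mem_span_charlierMap hq0 hq1 ha k)
  have h2 := fun k => hν.integral_eq hq0 hq1 ha (pow_mem_span_charlierMap hq0 hq1 ha k)
  have f1 := isFiniteMeasure_of_integrable_pow fun k => (h1 k).1
  have f2 := isFiniteMeasure_of_integrable_pow fun k => (h2 k).1
  exact ext_of_integral_pow_eq (ae_discreteMeasure_abs_le_one hq0 hq1) (fun k => (h1 k).1)
    (fun k => (h2 k).1) fun k => (h1 k).2.trans (h2 k).2.symm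

/-! ### Operators diagonal in a Hilbert basis -/

section Diagonal

variable {H : Type*} [NormedAddCommGroup H] [InnerProductSpace ℂ H]

lemma hilbertBasis_ext (f : HilbertBasis ℕ ℂ H) {x y : H}
    (h : ∀ n, inner ℂ (f n) x = inner ℂ (f n) y) : x = y := by
  refine f.repr.injective (lp.ext (funext fun n => ?_))
  rw [f.repr_apply_apply, f.repr_apply_apply, h]

lemma inner_hilbertBasis (f : HilbertBasis ℕ ℂ H) (m n : ℕ) :
    inner ℂ (f m) (f n) = if m = n then 1 else 0 :=
  orthonormal_iff_ite.1 f.orthonormal m n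

/-- `T` is diagonal in the Hilbert basis `f`, with eigenvalues `c`. -/
def IsDiagonal (f : HilbertBasis ℕ ℂ H) (c : ℕ → ℂ) (T : H →L[ℂ] H) : Prop :=
  ∀ n x, inner ℂ (f n) (T x) = c n * inner ℂ (f n) x

lemma exists_isDiagonal (f : HilbertBasis ℕ ℂ H) (c : ℕ → ℂ) {C : ℝ} (hC : 0 ≤ C)
    (hc : ∀ n, ‖c n‖ ≤ C) : ∃ T : H →L[ℂ] H, IsDiagonal f c T := by
  let D : lp (fun _ : ℕ => ℂ) 2 →L[ℂ] lp (fun _ : ℕ => ℂ) 2 :=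
    lp.mapCLM 2 (fun n => c n • ContinuousLinearMap.id ℂ ℂ) hC fun n => by
      rw [norm_smul]
      exact (mul_le_of_le_one_right (norm_nonneg _) ContinuousLinearMap.norm_id_le).trans (hc n)
  refine ⟨(f.repr.symm.toContinuousLinearEquiv : _ →L[ℂ] H) ∘L D ∘L
    (f.repr.toContinuousLinearEquiv : H →L[ℂ] _), fun n x => ?_⟩
  rw [← f.repr_apply_apply, ← f.repr_apply_apply]
  simp [D]

variable {f : HilbertBasis ℕ ℂ H} {c : ℕ → ℂ} {T : H →L[ℂ] H}

lemma IsDiagonal.apply (hT : IsDiagonal f c T) (n : ℕ) : T (f n) = c n • f n := by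
  refine hilbertBasis_ext f fun m => ?_
  rw [hT, inner_smul_right, inner_hilbertBasis]
  split_ifs with h
  · rw [h]
  · simp

lemma IsDiagonal.pow (hT : IsDiagonal f c T) (k n : ℕ) (x : H) :
    inner ℂ (f n) ((T ^ k) x) = c n ^ k * inner ℂ (f n) x := by
  induction k with
  | zero => simp
  | succ k ih =>
    rw [pow_succ', mul_apply_eq_comp, hT, ih, pow_succ']
    ring

lemma IsDiagonal.hasSum_inner_pow (hT : IsDiagonal f c T) (k : ℕ) (x y : H) :
    HasSum (fun n => inner ℂ y (f n) * inner ℂ (f n) x * c n ^ k) (inner ℂ y ((T ^ k) x)) := by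
  refine (f.hasSum_inner_mul_inner y ((T ^ k) x)).congr_fun fun n => ?_
  rw [hT.pow]
  ring

lemma IsDiagonal.hasEigenvector (hT : IsDiagonal f c T) (n : ℕ) :
    Module.End.HasEigenvector (T : H →ₗ[ℂ] H) (c n) (f n) := by
  refine Module.End.hasEigenvector_iff.2 ⟨Module.End.mem_eigenspace_iff.2 (hT.apply n), ?_⟩
  exact f.orthonormal.ne_zero n

lemma IsDiagonal.setOf_hasEigenvalue (hT : IsDiagonal f c T) :
    {z : ℂ | Module.End.HasEigenvalue (T : H →ₗ[ℂ] H) z} = Set.range c := by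
  ext z
  constructor
  · intro hz
    obtain ⟨x, hx⟩ := Module.End.HasEigenvalue.exists_hasEigenvector hz
    obtain ⟨hx1, hx0⟩ := Module.End.hasEigenvector_iff.1 hx
    have hx1 : T x = z • x := Module.End.mem_eigenspace_iff.1 hx1
    by_contra hne
    refine hx0 (hilbertBasis_ext f fun n => ?_)
    have h := hT n x
    rw [hx1, inner_smul_right] at h
    rw [inner_zero_right]
    have h2 : (z - c n) * inner ℂ (f n) x = 0 := by rw [sub_mul, h, sub_self]
    exact (mul_eq_zero.1 h2).resolve_left fun h0 => hne ⟨n, (sub_eq_zero.1 h0).symm⟩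
  · rintro ⟨n, rfl⟩
    exact Module.End.hasEigenvalue_of_hasEigenvector (hT.hasEigenvector n)

lemma IsDiagonal.finrank_eigenspace (hT : IsDiagonal f c T) (hc : Function.Injective c) (n : ℕ) :
    Module.finrank ℂ (Module.End.eigenspace (T : H →ₗ[ℂ] H) (c n)) = 1 := by
  have hmem := (Module.End.hasEigenvector_iff.1 (hT.hasEigenvector n)).1
  refine (finrank_eq_one_iff_of_nonzero' ⟨f n, hmem⟩ ?_).2 fun w => ⟨inner ℂ (f n) (w : H), ?_⟩
  · intro h
    exact f.orthonormal.ne_zero n (congrArg Subtype.val h)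
  · refine Subtype.ext (hilbertBasis_ext f fun m => ?_)
    have hw : T w = c n • (w : H) := Module.End.mem_eigenspace_iff.1 w.2
    have h := hT m w
    rw [hw, inner_smul_right] at h
    change inner ℂ (f m) (inner ℂ (f n) (w : H) • f n) = _
    rw [inner_smul_right, inner_hilbertBasis]
    split_ifs with hmn
    · rw [hmn, mul_one]
    · have h2 : (c n - c m) * inner ℂ (f m) (w : H) = 0 := by rw [sub_mul, h, sub_self]
      rw [(mul_eq_zero.1 h2).resolve_left fun h0 => hmn (hc (sub_eq_zero.1 h0)).symm, mul_zero]

/-- The resolvent is the diagonal operator with entries `(z - c n)⁻¹`, bounded by `δ⁻¹`. -/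
lemma IsDiagonal.notMem_spectrum (hT : IsDiagonal f c T) {z : ℂ} {δ : ℝ} (hδ : 0 < δ)
    (hz : ∀ n, δ ≤ ‖z - c n‖) : z ∉ spectrum ℂ T := by
  obtain ⟨S, hS⟩ := exists_isDiagonal f (fun n => (z - c n)⁻¹) (inv_nonneg.2 hδ.le)
    fun n => by rw [norm_inv]; exact inv_anti₀ hδ (hz n)
  have hne : ∀ n, z - c n ≠ 0 := fun n => norm_pos_iff.1 (hδ.trans_le (hz n))
  have hR : ∀ n x, inner ℂ (f n) ((algebraMap ℂ (H →L[ℂ] H) z - T) x) =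
      (z - c n) * inner ℂ (f n) x := by
    intro n x
    rw [Algebra.algebraMap_eq_smul_one]
    simp only [sub_apply, smul_apply,
      one_apply_eq_self]
    rw [inner_sub_right, inner_smul_right, hT, sub_mul]
  rw [spectrum.mem_iff, not_not]
  refine ⟨⟨algebraMap ℂ (H →L[ℂ] H) z - T, S, ?_, ?_⟩, rfl⟩
  · refine ContinuousLinearMap.ext fun x => hilbertBasis_ext f fun n => ?_
    rw [mul_apply_eq_comp, hR, hS, mul_inv_cancel_left₀ (hne n)]
    rfl
  · refine ContinuousLinearMap.ext fun x => hilbertBasis_ext f fun n => ?_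
    rw [mul_apply_eq_comp, hS, hR, inv_mul_cancel_left₀ (hne n)]
    rfl

lemma IsDiagonal.mem_spectrum (hT : IsDiagonal f c T) (n : ℕ) : c n ∈ spectrum ℂ T := by
  rw [spectrum.mem_iff]
  intro h
  obtain ⟨u, hu⟩ := h
  have h0 : (algebraMap ℂ (H →L[ℂ] H) (c n) - T) (f n) = 0 := by
    rw [Algebra.algebraMap_eq_smul_one]
    simp [hT.apply]
  have h1 : ((↑u⁻¹ : H →L[ℂ] H) * (u : H →L[ℂ] H)) (f n) = f n := by simp
  rw [mul_apply_eq_comp, hu, h0, map_zero] at h1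
  exact f.orthonormal.ne_zero n h1.symm

lemma IsDiagonal.spectrum_eq [CompleteSpace H] (hT : IsDiagonal f c T) (hc : Tendsto c atTop (𝓝 0)) :
    spectrum ℂ T = insert 0 (Set.range c) := by
  refine Set.Subset.antisymm (fun z hz => ?_) (Set.insert_subset ?_ ?_)
  · by_contra hne
    obtain ⟨δ, hδ, hball⟩ := Metric.isOpen_iff.1 hc.isCompact_insert_range.isClosed.isOpen_compl
      z hne
    refine hT.notMem_spectrum hδ (fun n => ?_) hz
    by_contra! hlt
    refine hball (?_ : c n ∈ Metric.ball z δ) (Set.mem_insert_of_mem _ ⟨n, rfl⟩)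
    rwa [Metric.mem_ball, dist_comm, dist_eq_norm]
  · exact (spectrum.isClosed T).mem_of_tendsto hc (Eventually.of_forall hT.mem_spectrum)
  · rintro _ ⟨n, rfl⟩
    exact hT.mem_spectrum n

lemma IsDiagonal.hasSum_quadratic {r : ℕ → ℝ} (hT : IsDiagonal f (fun n => (r n : ℂ)) T) (x : H) :
    HasSum (fun n => ((r n * ‖(inner ℂ (f n) x : ℂ)‖ ^ 2 : ℝ) : ℂ)) (inner ℂ x (T x)) := by
  refine (f.hasSum_inner_mul_inner x (T x)).congr_fun fun n => ?_
  rw [hT, ← inner_conj_symm x (f n)]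
  have := RCLike.conj_mul (inner ℂ (f n) x : ℂ)
  push_cast
  linear_combination -(r n : ℂ) * this

lemma IsDiagonal.isPositive {r : ℕ → ℝ} (hT : IsDiagonal f (fun n => (r n : ℂ)) T)
    (hr : ∀ n, 0 ≤ r n) : T.IsPositive := by
  have key : ∀ x, ∃ s : ℝ, 0 ≤ s ∧ inner ℂ x (T x) = (s : ℂ) := by
    intro x
    have h := hT.hasSum_quadratic x
    have hs := Complex.summable_ofReal.1 h.summable
    exact ⟨_, hs.hasSum.nonneg fun n => mul_nonneg (hr n) (sq_nonneg _),
      h.unique (Complex.hasSum_ofReal.2 hs.hasSum)⟩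
  rw [ContinuousLinearMap.isPositive_iff_complex]
  intro x
  obtain ⟨s, hs, he⟩ := key x
  rw [← inner_conj_symm, he]
  simpa using hs

lemma hasSum_norm_inner_sq {ι : Type*} (b : HilbertBasis ι ℂ H) (x : H) :
    HasSum (fun i => ‖(inner ℂ x (b i) : ℂ)‖ ^ 2) (‖x‖ ^ 2) := by
  rw [← Complex.hasSum_ofReal]
  have h := b.hasSum_inner_mul_inner x x
  rw [inner_self_eq_norm_sq_to_K] at h
  push_cast
  refine h.congr_fun fun i => ?_
  rw [← inner_conj_symm (b i) x]
  exact (RCLike.mul_conj _).symm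

end Diagonal

universe u

/-- Positivity gives `|T| = T`. The nonnegative double series `r n * |⟨f n, b i⟩|²` sums over `i` to
`r n` by Parseval, so it is summable and may be summed over `n` first. -/
lemma IsDiagonal.isTraceClass {H : Type u} [NormedAddCommGroup H] [InnerProductSpace ℂ H]
    [CompleteSpace H] {f : HilbertBasis ℕ ℂ H} {T : H →L[ℂ] H} {r : ℕ → ℝ}
    (hT : IsDiagonal f (fun n => (r n : ℂ)) T) (hr : ∀ n, 0 ≤ r n) (hs : Summable r) :
    IsTraceClass T := by
  intro ι b
  rw [CFC.abs_of_nonneg T ((ContinuousLinearMap.nonneg_iff_isPositive T).2 (hT.isPositive hr))]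
  have h1 : ∀ n, HasSum (fun i => r n * ‖(inner ℂ (f n) (b i) : ℂ)‖ ^ 2) (r n) := by
    intro n
    simpa [f.orthonormal.1 n] using (hasSum_norm_inner_sq b (f n)).mul_left (r n)
  have h2 : Summable fun p : ℕ × ι => r p.1 * ‖(inner ℂ (f p.1) (b p.2) : ℂ)‖ ^ 2 := by
    rw [summable_prod_of_nonneg fun p => mul_nonneg (hr _) (sq_nonneg _)]
    exact ⟨fun n => (h1 n).summable, hs.congr fun n => (h1 n).tsum_eq.symm⟩
  refine h2.prod_symm.prod.congr fun i => ?_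
  have h3 := hT.hasSum_quadratic (b i)
  have h4 := Complex.hasSum_ofReal.2 (Complex.summable_ofReal.1 h3.summable).hasSum
  rw [h3.unique h4]
  rfl

/-! ### Sequences on a geometric grid; accumulation points -/

section Sequences

/-- Nodes are peeled off from the largest: once the earlier `g j` vanish, division by `q^{nk}` and
`k → ∞` leave only `g n`, with `‖g j‖` as dominating series. -/
lemma eq_zero_of_hasSum_mul_pow {q : ℝ} (hq0 : 0 < q) (hq1 : q < 1) {g : ℕ → ℂ}
    (h : ∀ k : ℕ, HasSum (fun n => g n * ((q : ℂ) ^ n) ^ k) 0) (n : ℕ) : g n = 0 := by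
  induction n using Nat.strong_induction_on with
  | _ n ih =>
  have hs : Summable fun j => ‖g j‖ := by simpa using (h 0).summable.norm
  have hq : (q : ℂ) ≠ 0 := by exact_mod_cast hq0.ne'
  have hF : ∀ k : ℕ, ∑' j, g j * ((q : ℂ) ^ j / (q : ℂ) ^ n) ^ k = 0 := by
    intro k
    have := (h k).mul_right ((((q : ℂ) ^ n) ^ k)⁻¹)
    rw [zero_mul] at this
    refine (this.congr_fun fun j => ?_).tsum_eq
    rw [div_pow, mul_assoc, div_eq_mul_inv]
  have hquot : ∀ j, n ≤ j → (q : ℂ) ^ j / (q : ℂ) ^ n = (q : ℂ) ^ (j - n) := by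
    intro j hj
    rw [div_eq_iff (pow_ne_zero n hq), ← pow_add, Nat.sub_add_cancel hj]
  have ht := tendsto_tsum_of_dominated_convergence (𝓕 := atTop)
    (f := fun (k : ℕ) j => g j * ((q : ℂ) ^ j / (q : ℂ) ^ n) ^ k)
    (g := fun j => if j = n then g n else 0) hs (fun j => ?_) (Eventually.of_forall fun k j => ?_)
  · simp only [hF, tsum_ite_eq] at ht
    exact (tendsto_nhds_unique ht tendsto_const_nhds)
  · rcases lt_trichotomy j n with hj | rfl | hj
    · simp [ih j hj, hj.ne]
    · simp [pow_ne_zero j hq]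
    · rw [if_neg hj.ne', hquot j hj.le]
      have : Tendsto (fun k : ℕ => ((q : ℂ) ^ (j - n)) ^ k) atTop (𝓝 0) := by
        refine tendsto_pow_atTop_nhds_zero_of_norm_lt_one ?_
        rw [norm_pow, Complex.norm_of_nonneg hq0.le]
        exact pow_lt_one₀ hq0.le hq1 (Nat.sub_ne_zero_of_lt hj)
      simpa using this.const_mul (g j)
  · rcases lt_or_ge j n with hj | hj
    · simp [ih j hj]
    · rw [hquot j hj, norm_mul, norm_pow, norm_pow, Complex.norm_of_nonneg hq0.le]
      exact mul_le_of_le_one_right (norm_nonneg _)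
        (pow_le_one₀ (pow_nonneg hq0.le _) (pow_le_one₀ hq0.le hq1.le))

lemma tendsto_complex_pow {q : ℝ} (hq0 : 0 < q) (hq1 : q < 1) :
    Tendsto (fun n : ℕ => (q : ℂ) ^ n) atTop (𝓝 0) :=
  tendsto_pow_atTop_nhds_zero_of_norm_lt_one (by rwa [Complex.norm_of_nonneg hq0.le])

lemma derivedSet_insert_zero_range {c : ℕ → ℂ} (hc : Tendsto c atTop (𝓝 0)) (h0 : ∀ n, c n ≠ 0) :
    derivedSet (insert 0 (Set.range c)) = {0} := by
  ext x
  rw [mem_derivedSet, accPt_iff_nhds, Set.mem_singleton_iff]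
  constructor
  · intro h
    by_contra hx
    have hx' : 0 < ‖x‖ / 2 := by positivity
    obtain ⟨N, hN⟩ := eventually_atTop.1 ((tendsto_zero_iff_norm_tendsto_zero.1 hc).eventually_lt_const hx')
    have hfin : (c '' Set.Iio N \ {x}).Finite := ((Set.finite_Iio N).image c).sdiff
    -- Beyond `‖x‖ / 2` lie only values `c m` with `m < N`; removing those other than `x` isolates
    -- `x`.
    have hU : (c '' Set.Iio N \ {x})ᶜ ∩ {z : ℂ | ‖x‖ / 2 < ‖z‖} ∈ 𝓝 x := by
      refine inter_mem (hfin.isClosed.isOpen_compl.mem_nhds (by simp)) ?_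
      exact (isOpen_lt continuous_const continuous_norm).mem_nhds
        (half_lt_self (norm_pos_iff.2 hx))
    obtain ⟨y, ⟨⟨hy1, hy2⟩, hyK⟩, hne⟩ := h _ hU
    rcases hyK with rfl | ⟨m, rfl⟩
    · have : ‖x‖ / 2 < ‖(0 : ℂ)‖ := hy2
      rw [norm_zero] at this
      linarith
    · refine hy1 ⟨⟨m, ?_, rfl⟩, hne⟩
      by_contra hm
      have h2 : ‖x‖ / 2 < ‖c m‖ := hy2
      exact lt_asymm h2 (hN m (not_lt.1 hm))
  · rintro rfl U hU
    obtain ⟨n, hn⟩ := (hc.eventually hU).exists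
    exact ⟨c n, ⟨hn, Set.mem_insert_of_mem _ ⟨n, rfl⟩⟩, h0 n⟩

end Sequences

/-! ### Normalization and completeness -/

section Coefficients

variable {a q : ℝ}

lemma offDiag_nonpos (hq0 : 0 < q) (ha : 0 < a) (m : ℕ) : offDiag a q m ≤ 0 := by
  unfold offDiag
  exact neg_nonpos.2 (by positivity)

lemma offDiag_sq (hq0 : 0 < q) (hq1 : q < 1) (ha : 0 < a) (m : ℕ) :
    offDiag a q m ^ 2 = raiseCoeff a q m * lowerCoeff a q m := by
  have h := one_sub_pow_pos hq0 hq1 m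
  rw [offDiag, neg_sq, mul_pow, div_pow, mul_pow, Real.sq_sqrt (by positivity),
    Real.sq_sqrt (by positivity), Real.sq_sqrt (by positivity), raiseCoeff, lowerCoeff,
    show 3 * m + 1 = m + (2 * m + 1) by ring, pow_add q m]
  field_simp

/-- The minus sign in `a_m` matches that of `-A_m`, so comparing squares suffices. -/
lemma offDiag_mul_sqrt (hq0 : 0 < q) (hq1 : q < 1) (ha : 0 < a) (m : ℕ) :
    offDiag a q m * √(normSq a q m) = -raiseCoeff a q m * √(normSq a q (m + 1)) := by
  have h1 := offDiag_nonpos hq0 ha m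
  have h2 := (raiseCoeff_pos hq0 ha m).le
  rw [← neg_inj, neg_mul, neg_neg, ← neg_mul]
  refine (sq_eq_sq₀ (mul_nonneg (neg_nonneg.2 h1) (Real.sqrt_nonneg _))
    (mul_nonneg h2 (Real.sqrt_nonneg _))).1 ?_
  rw [mul_pow, mul_pow, Real.sq_sqrt (normSq_pos hq0 hq1 ha _).le,
    Real.sq_sqrt (normSq_pos hq0 hq1 ha _).le, neg_sq, offDiag_sq hq0 hq1 ha]
  linear_combination -raiseCoeff a q m * raiseCoeff_mul_normSq hq0 hq1 ha m

lemma offDiag_mul_sqrt_succ (hq0 : 0 < q) (hq1 : q < 1) (ha : 0 < a) (m : ℕ) :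
    offDiag a q m * √(normSq a q (m + 1)) = -lowerCoeff a q m * √(normSq a q m) := by
  have h1 := offDiag_nonpos hq0 ha m
  have h2 := (lowerCoeff_pos hq0 hq1 ha m).le
  rw [← neg_inj, neg_mul, neg_neg, ← neg_mul]
  refine (sq_eq_sq₀ (mul_nonneg (neg_nonneg.2 h1) (Real.sqrt_nonneg _))
    (mul_nonneg h2 (Real.sqrt_nonneg _))).1 ?_
  rw [mul_pow, mul_pow, Real.sq_sqrt (normSq_pos hq0 hq1 ha _).le,
    Real.sq_sqrt (normSq_pos hq0 hq1 ha _).le, neg_sq, offDiag_sq hq0 hq1 ha]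
  linear_combination lowerCoeff a q m * raiseCoeff_mul_normSq hq0 hq1 ha m

/-- The value at `q ^ n` of the `m`-th orthonormal polynomial, times the square root of the
weight at `q ^ n`. -/
def normalized (a q : ℝ) (m n : ℕ) : ℝ :=
  √(weight a q n) * altCharlier a q m (q ^ n) / √(normSq a q m)

lemma mul_normalized_zero (hq0 : 0 < q) (hq1 : q < 1) (ha : 0 < a) (n : ℕ) :
    q ^ n * normalized a q 0 n =
      offDiag a q 0 * normalized a q 1 n + diag a q 0 * normalized a q 0 n := by
  have h1 := mul_altCharlier_zero hq0 hq1 ha (q ^ n)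
  have h2 := offDiag_mul_sqrt hq0 hq1 ha 0
  have s0 := (Real.sqrt_pos.2 (normSq_pos hq0 hq1 ha 0)).ne'
  have s1 := (Real.sqrt_pos.2 (normSq_pos hq0 hq1 ha 1)).ne'
  simp only [normalized]
  rw [zero_add] at h2
  field_simp
  linear_combination √(weight a q n) * √(normSq a q 1) * h1 -
    √(weight a q n) * altCharlier a q 1 (q ^ n) * h2

lemma mul_normalized_succ (hq0 : 0 < q) (hq1 : q < 1) (ha : 0 < a) (m n : ℕ) :
    q ^ n * normalized a q (m + 1) n = offDiag a q (m + 1) * normalized a q (m + 2) n +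
      offDiag a q m * normalized a q m n + diag a q (m + 1) * normalized a q (m + 1) n := by
  have h1 := mul_altCharlier_succ hq0 hq1 ha m (q ^ n)
  have h2 := offDiag_mul_sqrt hq0 hq1 ha (m + 1)
  have h3 := offDiag_mul_sqrt_succ hq0 hq1 ha m
  have s0 := (Real.sqrt_pos.2 (normSq_pos hq0 hq1 ha m)).ne'
  have s1 := (Real.sqrt_pos.2 (normSq_pos hq0 hq1 ha (m + 1))).ne'
  have s2 := (Real.sqrt_pos.2 (normSq_pos hq0 hq1 ha (m + 2))).ne'
  simp only [normalized]
  field_simp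
  linear_combination √(weight a q n) * √(normSq a q m) * √(normSq a q (m + 2)) * h1 -
    √(weight a q n) * √(normSq a q m) * altCharlier a q (m + 2) (q ^ n) * h2 -
    √(weight a q n) * √(normSq a q (m + 2)) * altCharlier a q m (q ^ n) * h3

lemma hasSum_normalized_mul (hq0 : 0 < q) (hq1 : q < 1) (ha : 0 < a) (m m' : ℕ) :
    HasSum (fun n => normalized a q m n * normalized a q m' n) (if m = m' then 1 else 0) := by
  have h := (hasSum_altCharlier_mul hq0 hq1 ha m m').mul_right
    ((√(normSq a q m))⁻¹ * (√(normSq a q m'))⁻¹)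
  have hv : (if m = m' then normSq a q m else 0) * ((√(normSq a q m))⁻¹ * (√(normSq a q m'))⁻¹) =
      if m = m' then 1 else 0 := by
    split_ifs with hm
    · subst hm
      have h0 := normSq_pos hq0 hq1 ha m
      rw [← mul_inv, Real.mul_self_sqrt h0.le, mul_inv_cancel₀ h0.ne']
    · rw [zero_mul]
  rw [hv] at h
  refine h.congr_fun fun n => ?_
  have := Real.mul_self_sqrt (weight_pos hq0 hq1 ha n).le
  rw [← this, normalized, normalized]
  ring

lemma normalized_zero_sq (hq0 : 0 < q) (hq1 : q < 1) (ha : 0 < a) (n : ℕ) :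
    normalized a q 0 n * normalized a q 0 n = weight a q n / qPochInf (-a * q) q := by
  rw [normalized, altCharlier_zero hq0, mul_one, div_mul_div_comm,
    Real.mul_self_sqrt (weight_pos hq0 hq1 ha n).le,
    Real.mul_self_sqrt (normSq_pos hq0 hq1 ha 0).le, normSq_zero hq0 hq1 ha]

lemma normalized_zero_ne_zero (hq0 : 0 < q) (hq1 : q < 1) (ha : 0 < a) (n : ℕ) :
    normalized a q 0 n ≠ 0 := by
  rw [normalized, altCharlier_zero hq0, mul_one]
  exact (div_pos (Real.sqrt_pos.2 (weight_pos hq0 hq1 ha n))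
    (Real.sqrt_pos.2 (normSq_pos hq0 hq1 ha 0))).ne'

/-- Completeness: by linearity the hypothesis passes from the `K_m` to all monomials, so `√w_n x_n`
has vanishing power moments on the nodes. -/
lemma eq_zero_of_hasSum_normalized (hq0 : 0 < q) (hq1 : q < 1) (ha : 0 < a) {x : ℕ → ℂ}
    (h : ∀ m, HasSum (fun n => (normalized a q m n : ℂ) * x n) 0) (n : ℕ) : x n = 0 := by
  have key : ∀ f ∈ Submodule.span ℝ (Set.range (charlierMap a hq0)),
      HasSum (fun n => ((√(weight a q n) * f (q ^ n) : ℝ) : ℂ) * x n) 0 := by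
    intro f hf
    induction hf using Submodule.span_induction with
    | mem f hf =>
      obtain ⟨m, rfl⟩ := hf
      have h0 := (Real.sqrt_pos.2 (normSq_pos hq0 hq1 ha m)).ne'
      have h1 := (h m).mul_left ((√(normSq a q m) : ℝ) : ℂ)
      rw [mul_zero] at h1
      refine h1.congr_fun fun n => ?_
      rw [← mul_assoc, ← Complex.ofReal_mul, normalized, mul_div_cancel₀ _ h0]
      rfl
    | zero => simp
    | add f g _ _ hf hg =>
      have := hf.add hg
      rw [add_zero] at this
      refine this.congr_fun fun n => ?_
      rw [ContinuousMap.add_apply]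
      push_cast
      ring
    | smul c f _ hf =>
      have := hf.mul_left (c : ℂ)
      rw [mul_zero] at this
      refine this.congr_fun fun n => ?_
      rw [ContinuousMap.smul_apply, smul_eq_mul]
      push_cast
      ring
  have hz := eq_zero_of_hasSum_mul_pow hq0 hq1 (g := fun n => ((√(weight a q n) : ℝ) : ℂ) * x n)
    (fun k => (key _ (pow_mem_span_charlierMap hq0 hq1 ha k)).congr_fun fun n => by
      simp only [ContinuousMap.pow_apply, ContinuousMap.id_apply]
      push_cast
      ring) n
  refine (mul_eq_zero.1 hz).resolve_left ?_
  exact_mod_cast (Real.sqrt_pos.2 (weight_pos hq0 hq1 ha n)).ne'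

/-- The orthonormal polynomials as vectors in `ℓ²`. -/
def normalizedVec (hq0 : 0 < q) (hq1 : q < 1) (ha : 0 < a) (m : ℕ) : lp (fun _ : ℕ => ℂ) 2 :=
  ⟨fun n => (normalized a q m n : ℂ), memℓp_gen <| by
    refine (hasSum_normalized_mul hq0 hq1 ha m m).summable.congr fun n => ?_
    rw [Complex.norm_real, Real.norm_eq_abs]
    simp [← sq]⟩

lemma orthonormal_normalizedVec (hq0 : 0 < q) (hq1 : q < 1) (ha : 0 < a) :
    Orthonormal ℂ (normalizedVec hq0 hq1 ha) := by
  rw [orthonormal_iff_ite]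
  intro m m'
  have h := Complex.hasSum_ofReal.2 (hasSum_normalized_mul hq0 hq1 ha m m')
  have h2 := lp.hasSum_inner (𝕜 := ℂ) (normalizedVec hq0 hq1 ha m) (normalizedVec hq0 hq1 ha m')
  rw [h2.unique (h.congr_fun fun n => ?_)]
  · split_ifs <;> simp
  · simp [normalizedVec, mul_comm]

lemma orthogonal_normalizedVec (hq0 : 0 < q) (hq1 : q < 1) (ha : 0 < a) :
    (Submodule.span ℂ (Set.range (normalizedVec hq0 hq1 ha)))ᗮ = ⊥ := by
  refine (Submodule.eq_bot_iff _).2 fun x hx => lp.ext (funext fun n => ?_)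
  refine eq_zero_of_hasSum_normalized hq0 hq1 ha (x := fun n => x n) (fun m => ?_) n
  have h := lp.hasSum_inner (𝕜 := ℂ) (normalizedVec hq0 hq1 ha m) x
  rw [(Submodule.mem_orthogonal _ _).1 hx _ (Submodule.subset_span ⟨m, rfl⟩)] at h
  refine h.congr_fun fun n => ?_
  simp [normalizedVec, mul_comm]

/-- The unitary map onto `ℓ²` taking `e m` to `normalizedVec m` pulls the standard unit vectors back
to `f`. -/
lemma exists_hilbertBasis_inner_eq {H : Type*} [NormedAddCommGroup H] [InnerProductSpace ℂ H]
    (e : HilbertBasis ℕ ℂ H) (hq0 : 0 < q) (hq1 : q < 1) (ha : 0 < a) :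
    ∃ f : HilbertBasis ℕ ℂ H, ∀ n m, inner ℂ (f n) (e m) = (normalized a q m n : ℂ) := by
  let b := HilbertBasis.mkOfOrthogonalEqBot (orthonormal_normalizedVec hq0 hq1 ha)
    (orthogonal_normalizedVec hq0 hq1 ha)
  refine ⟨HilbertBasis.ofRepr (e.repr.trans b.repr.symm), fun n m => ?_⟩
  rw [← HilbertBasis.repr_apply_apply]
  change ((b.repr.symm (e.repr (e m)) : lp (fun _ : ℕ => ℂ) 2) : ℕ → ℂ) n = _
  rw [e.repr_self, b.repr_symm_single, HilbertBasis.coe_mkOfOrthogonalEqBot]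
  rfl

end Coefficients

/-! ### The Jacobi operator in its eigenbasis -/

section Operator

variable {H : Type*} [NormedAddCommGroup H] [InnerProductSpace ℂ H] {a q : ℝ}
  {e f : HilbertBasis ℕ ℂ H}

lemma inner_jacobi_zero (hq0 : 0 < q) (hq1 : q < 1) (ha : 0 < a)
    (hf : ∀ n m, inner ℂ (f n) (e m) = (normalized a q m n : ℂ)) (n : ℕ) :
    inner ℂ (f n) ((offDiag a q 0 : ℂ) • e 1 + (diag a q 0 : ℂ) • e 0) =
      (q : ℂ) ^ n * inner ℂ (f n) (e 0) := by
  rw [inner_add_right, inner_smul_right, inner_smul_right, hf, hf]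
  exact_mod_cast (mul_normalized_zero hq0 hq1 ha n).symm

lemma inner_jacobi_succ (hq0 : 0 < q) (hq1 : q < 1) (ha : 0 < a)
    (hf : ∀ n m, inner ℂ (f n) (e m) = (normalized a q m n : ℂ)) (m n : ℕ) :
    inner ℂ (f n) ((offDiag a q (m + 1) : ℂ) • e (m + 2) +
      (offDiag a q m : ℂ) • e m + (diag a q (m + 1) : ℂ) • e (m + 1)) =
      (q : ℂ) ^ n * inner ℂ (f n) (e (m + 1)) := by
  rw [inner_add_right, inner_add_right, inner_smul_right, inner_smul_right, inner_smul_right,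
    hf, hf, hf]
  exact_mod_cast (mul_normalized_succ hq0 hq1 ha m n).symm

/-- For fixed `n` the recurrence at `x = q^n` says that `⟨f n, T ·⟩` and `q^n ⟨f n, ·⟩` agree on
every `e m`; density of their span and continuity do the rest. -/
lemma isJacobiOperator_iff_isDiagonal (hq0 : 0 < q) (hq1 : q < 1) (ha : 0 < a)
    (hf : ∀ n m, inner ℂ (f n) (e m) = (normalized a q m n : ℂ)) (T : H →L[ℂ] H) :
    IsJacobiOperator a q e T ↔ IsDiagonal f (fun n => (q : ℂ) ^ n) T := by
  constructor
  · rintro ⟨h0, h1⟩ n x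
    have hd : Dense (Submodule.span ℂ (Set.range e) : Set H) :=
      Submodule.dense_iff_topologicalClosure_eq_top.2 e.dense_span
    have := ContinuousLinearMap.ext_on hd (f := (innerSL ℂ (f n)) ∘L T)
      (g := (q : ℂ) ^ n • innerSL ℂ (f n)) (by
        rintro _ ⟨m, rfl⟩
        rcases m with _ | m
        · change inner ℂ (f n) (T (e 0)) = (q : ℂ) ^ n * inner ℂ (f n) (e 0)
          rw [h0, inner_jacobi_zero hq0 hq1 ha hf]
        · change inner ℂ (f n) (T (e (m + 1))) = (q : ℂ) ^ n * inner ℂ (f n) (e (m + 1))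
          rw [h1, inner_jacobi_succ hq0 hq1 ha hf])
    simpa using congrArg (fun L => L x) this
  · intro hT
    exact ⟨hilbertBasis_ext f fun n => by rw [hT, inner_jacobi_zero hq0 hq1 ha hf],
      fun m => hilbertBasis_ext f fun n => by rw [hT, inner_jacobi_succ hq0 hq1 ha hf]⟩

/-- If `x` is orthogonal to every `T^k v`, the sequence `⟨x, f n⟩⟨f n, v⟩` has vanishing power
moments, so it is zero. -/
lemma IsDiagonal.hasSimpleSpectrum [CompleteSpace H] {T : H →L[ℂ] H} (hq0 : 0 < q) (hq1 : q < 1)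
    (hT : IsDiagonal f (fun n => (q : ℂ) ^ n) T) {v : H} (hv : ∀ n, inner ℂ (f n) v ≠ 0) :
    HasSimpleSpectrum T := by
  refine ⟨v, Submodule.topologicalClosure_eq_top_iff.2 ((Submodule.eq_bot_iff _).2 fun x hx => ?_)⟩
  have hz : ∀ n, inner ℂ x (f n) * inner ℂ (f n) v = 0 := by
    refine eq_zero_of_hasSum_mul_pow hq0 hq1 fun k => ?_
    have h := hT.hasSum_inner_pow k v x
    rwa [← inner_conj_symm x, (Submodule.mem_orthogonal _ _).1 hx _
      (Submodule.subset_span ⟨k, rfl⟩), map_zero] at h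
  refine hilbertBasis_ext f fun n => ?_
  rw [← inner_conj_symm, (mul_eq_zero.1 (hz n)).resolve_right (hv n), map_zero, inner_zero_right]

end Operator

end AltQCharlier

end

theorem mainTheorem2 {H : Type*} [NormedAddCommGroup H] [InnerProductSpace ℂ H] [CompleteSpace H]
    (e : HilbertBasis ℕ ℂ H) (q a : ℝ) (hq0 : 0 < q) (hq1 : q < 1) (ha : 0 < a) :
    -- the Jacobi matrix defines one and only one bounded operator `I₁`
    (∃! T : H →L[ℂ] H, AltQCharlier.IsJacobiOperator a q e T) ∧
    (∀ I₁ : H →L[ℂ] H, AltQCharlier.IsJacobiOperator a q e I₁ →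
      IsSelfAdjoint I₁ ∧
      AltQCharlier.IsTraceClass I₁ ∧
      -- the spectrum: the eigenvalues `q ^ n`, and their limit `0`, which is not an eigenvalue
      {z : ℂ | Module.End.HasEigenvalue (I₁ : H →ₗ[ℂ] H) z} =
        Set.range (fun n : ℕ => (q : ℂ) ^ n) ∧
      spectrum ℂ I₁ = insert 0 (Set.range fun n : ℕ => (q : ℂ) ^ n) ∧
      derivedSet (spectrum ℂ I₁) = {0} ∧
      -- the spectrum is simple
      AltQCharlier.HasSimpleSpectrum I₁ ∧
      (∀ n : ℕ, Module.finrank ℂ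
        (Module.End.eigenspace (I₁ : H →ₗ[ℂ] H) ((q : ℂ) ^ n)) = 1) ∧
      -- the normalized weights are the spectral measure of `I₁` at the vector `e 0`
      (∀ k : ℕ, HasSum
        (fun n : ℕ => ((AltQCharlier.weight a q n / AltQCharlier.qPochInf (-a * q) q : ℝ) : ℂ) *
          ((q : ℂ) ^ n) ^ k)
        (inner ℂ (e 0) ((I₁ ^ k) (e 0))))) ∧
    -- the discrete orthogonality relation
    (∀ m m' : ℕ, HasSum
      (fun n : ℕ => AltQCharlier.weight a q n * AltQCharlier.altCharlier a q m (q ^ n) *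
        AltQCharlier.altCharlier a q m' (q ^ n))
      (if m = m' then AltQCharlier.normSq a q m else 0)) ∧
    -- there is no other orthogonality measure, hence no further mass
    (∀ μ : MeasureTheory.Measure ℝ,
      AltQCharlier.IsOrthogonalityMeasure a q μ ↔ μ = AltQCharlier.discreteMeasure a q) := by
  obtain ⟨f, hf⟩ := AltQCharlier.exists_hilbertBasis_inner_eq e hq0 hq1 ha
  have hiff := AltQCharlier.isJacobiOperator_iff_isDiagonal hq0 hq1 ha hf
  have hinj : Function.Injective fun n : ℕ => (q : ℂ) ^ n := by
    intro m n (h : (q : ℂ) ^ m = (q : ℂ) ^ n)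
    have h' : q ^ m = q ^ n := by exact_mod_cast h
    exact pow_right_injective₀ hq0 hq1.ne h'
  have hlim := AltQCharlier.tendsto_complex_pow hq0 hq1
  refine ⟨?_, fun T hT => ?_, AltQCharlier.hasSum_altCharlier_mul hq0 hq1 ha,
    AltQCharlier.isOrthogonalityMeasure_iff hq0 hq1 ha⟩
  · obtain ⟨T, hT⟩ := AltQCharlier.exists_isDiagonal f (fun n => (q : ℂ) ^ n) zero_le_one
      fun n => by
        rw [norm_pow, Complex.norm_of_nonneg hq0.le]
        exact pow_le_one₀ hq0.le hq1.le
    refine ⟨T, (hiff T).2 hT, fun S hS => ContinuousLinearMap.ext fun x =>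
      AltQCharlier.hilbertBasis_ext f fun n => ?_⟩
    rw [(hiff S).1 hS, hT]
  · have hD := (hiff T).1 hT
    have hD' : AltQCharlier.IsDiagonal f (fun n => ((q ^ n : ℝ) : ℂ)) T := by
      simpa only [Complex.ofReal_pow] using hD
    have hnn : ∀ n, 0 ≤ q ^ n := fun n => pow_nonneg hq0.le n
    refine ⟨(hD'.isPositive hnn).isSelfAdjoint,
      hD'.isTraceClass hnn (summable_geometric_of_lt_one hq0.le hq1), hD.setOf_hasEigenvalue,
      hD.spectrum_eq hlim, ?_, hD.hasSimpleSpectrum hq0 hq1 (v := e 0) fun n => ?_,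
      hD.finrank_eigenspace hinj, fun k => ?_⟩
    · rw [hD.spectrum_eq hlim]
      exact AltQCharlier.derivedSet_insert_zero_range hlim fun n =>
        pow_ne_zero n (by exact_mod_cast hq0.ne')
    -- `K_0 = 1`, so `e 0` has a nonzero component along every eigenvector and is cyclic.
    · rw [hf]
      exact_mod_cast AltQCharlier.normalized_zero_ne_zero hq0 hq1 ha n
    · refine (hD.hasSum_inner_pow k (e 0) (e 0)).congr_fun fun n => ?_
      rw [← inner_conj_symm (e 0) (f n), hf, Complex.conj_ofReal, ← Complex.ofReal_mul,
        AltQCharlier.normalized_zero_sq hq0 hq1 ha]
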